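/- Let $q$ be a power of a prime $p$ and let $k,m,d_1,\dots,d_m$ be positive integers with $m\le (k-1)/2$, $2\le d_1<d_2<\cdots<d_m$ and $p\nmid d_j$ for all $1\le j\le m$. Let $b_1,\dots,b_m\in\mathbb F_q$, put $$f_j:=X_1^{d_j}+\cdots+X_k^{d_j}-b_j\in\mathbb F_q[X_1,\dots,X_k]\qquad(1\le j\le m),$$ and let $V:=V(f_1,\dots,f_m)\subset\mathbb A^k=\overline{\mathbb F}_q^{\,k}$ be the set of common zeros of $f_1,\dots,f_m$. Let $\mathbb K$ be either $\mathbb F_q$ or $\overline{\mathbb F}_q$. **Theorem.** The variety $V$ is, as a $\mathbb K$-variety, an (ideal-theoretic) complete intersection of pure dimension $k-m$: it has dimension $k-m$ (in particular it is nonempty), all its irreducible $\mathbb K$-components have dimension $k-m$, and the ideal $(f_1,\dots,f_m)$ of $\mathbb K[X_1,\dots,X_k]$ is radical. Moreover $$\deg V\le d_1\cdots d_m .$$ Here an (affine) $\mathbb K$-variety is the zero set in $\mathbb A^k$ of polynomials with coefficients in $\mathbb K$; it is irreducible if it is nonempty and is not the union of two proper $\mathbb K$-subvarieties; the dimension of a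 $\mathbb K$-variety is the maximal length $n$ of a chain $V_0\subsetneq\cdots\subsetneq V_n$ of irreducible $\mathbb K$-varieties contained in it. The degree of an irreducible $\mathbb K$-variety $C$ is the maximum of $|C\cap L|$ over all affine linear subspaces $L\subseteq\mathbb A^k$ of codimension $\dim C$ with $C\cap L$ finite, and $\deg V$ is the sum of the degrees of the irreducible $\mathbb K$-components of $V$. -/

import Mathlib

noncomputable section

namespace AffineVariety

variable (K : Type*) {Ω : Type*} [Field K] [Field Ω] [Algebra K Ω] {r : ℕ}

/-- `V ⊆ Ω ^ r` is an affine `K`-variety: the common zero locus in `Ω ^ r` of polynomials with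
coefficients in `K`. (Ideals of `K[X_1, …, X_r]` are finitely generated, so this is the same as
the zero locus of finitely many polynomials.) -/
def IsVariety (V : Set (Fin r → Ω)) : Prop :=
  ∃ I : Ideal (MvPolynomial (Fin r) K), V = MvPolynomial.zeroLocus Ω I

/-- A `K`-variety is irreducible if it is nonempty and it is not the union of two proper
`K`-subvarieties. -/
def IsIrreducibleVariety (V : Set (Fin r → Ω)) : Prop :=
  IsVariety K V ∧ V.Nonempty ∧
    ∀ V₁ V₂ : Set (Fin r → Ω), IsVariety K V₁ → IsVariety K V₂ → V = V₁ ∪ V₂ → V = V₁ ∨ V = V₂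

/-- The irreducible `K`-components of `V`: the maximal irreducible `K`-varieties contained
in `V`. -/
def IsComponent (V C : Set (Fin r → Ω)) : Prop :=
  Maximal (fun W : Set (Fin r → Ω) => IsIrreducibleVariety K W ∧ W ⊆ V) C

/-- The dimension of `V`: the supremum of the lengths `n` of the chains
`V₀ ⊊ V₁ ⊊ ⋯ ⊊ Vₙ` of (nonempty) irreducible `K`-varieties contained in `V`
(it is `⊥` for the empty set). -/
def dim (V : Set (Fin r → Ω)) : WithBot ℕ∞ :=
  Order.krullDim {W : Set (Fin r → Ω) // IsIrreducibleVariety K W ∧ W ⊆ V}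

/-- `V` has pure dimension `n`: its dimension is `n` (so `V` is nonempty), and so is the
dimension of each of its irreducible `K`-components. -/
def HasPureDim (V : Set (Fin r → Ω)) (n : ℕ) : Prop :=
  dim K V = n ∧ ∀ C, IsComponent K V C → dim K C = n

/-- The degree of an irreducible `K`-variety `C`: the largest number of points of `C ∩ L`, over
all affine linear subspaces `L` of `Ω ^ r` of codimension `dim C` for which `C ∩ L` is finite. -/
def degIrreducible (C : Set (Fin r → Ω)) : ℕ∞ :=
  ⨆ L ∈ {L : AffineSubspace Ω (Fin r → Ω) | (L : Set (Fin r → Ω)).Nonempty ∧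
      (Module.finrank Ω L.direction : WithBot ℕ∞) + dim K C = r ∧
      (C ∩ (L : Set (Fin r → Ω))).Finite},
    (C ∩ (L : Set (Fin r → Ω))).encard

/-- The degree of a `K`-variety `V`: the sum of the degrees of its irreducible `K`-components
(written as the supremum of the finite partial sums; there are finitely many components). -/
def degree (V : Set (Fin r → Ω)) : ℕ∞ :=
  ⨆ s : Finset {C : Set (Fin r → Ω) // IsComponent K V C}, ∑ C ∈ s, degIrreducible K C.1

variable {K}

variable (Ω) in
/-- The affine variety `V(F_1, …, F_m) ⊆ Ω ^ r`. -/
def zeros {m : ℕ} (F : Fin m → MvPolynomial (Fin r) K) : Set (Fin r → Ω) :=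
  {x | ∀ j, MvPolynomial.aeval x (F j) = 0}

variable (Ω) in
/-- `F_1, …, F_m ∈ K[X_1, …, X_r]`, `m ≤ r`, define an (ideal-theoretic) complete intersection:
`V(F_1, …, F_m)` has pure dimension `r - m` and the ideal `(F_1, …, F_m)` of `K[X_1, …, X_r]`
is radical. -/
def IsCompleteIntersection {m : ℕ} (F : Fin m → MvPolynomial (Fin r) K) : Prop :=
  m ≤ r ∧ HasPureDim K (zeros Ω F) (r - m) ∧ (Ideal.span (Set.range F)).IsRadical

/-- The polynomials `f_j = X_1 ^ d_j + ⋯ + X_k ^ d_j - b_j`. -/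
def diagonal (k : ℕ) {m : ℕ} (d : Fin m → ℕ) (b : Fin m → K) (j : Fin m) :
    MvPolynomial (Fin k) K :=
  (∑ i, MvPolynomial.X i ^ d j) - MvPolynomial.C (b j)

end AffineVariety

end

/-! Write `J` for the ideal generated by the `f_j`, and `A` for the polynomial ring. Everything
rests on a dichotomy at the generic point of a prime `P ⊇ J`, read off the Jacobian matrix `(d_j X_i
^ (d_j - 1))`. If its rows are independent, some maximal minor is invertible, and the function field
of `P` is separable algebraic over the field generated by the `k - m` coordinates outside the minor.
If they are dependent, a single nonzero univariate polynomial, with distinct exponents `d_j - 1`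
and, after normalization, at most `m - 1` varying coefficients, annihilates every coordinate, so the
dimension is at most `m - 1`. For `2 * m ≤ k + 1` both cases give `dim A / P ≤ k - m`.

This upper bound, applied to each initial segment of the system, makes the `f_j` a regular sequence
over an algebraically closed field. A zero divisor would lie in an associated prime `P` whose
quotient is too small, because depth at a point bounds below the length of prime chains starting at
any associated prime contained in the ideal of the point. Hence every associated prime of `J` has
dimension exactly `k - m`; there are no embedded primes. Since `2 * m ≤ k`, the dependent case
cannot occur at such a prime, and there the Jacobian criterion makes the localization of `A / J`
reduced. So `J` is radical. Nonemptiness follows by homogenizing: an empty `V` would leave only the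
zeros at infinity, whose cone has dimension at most `k - m`, too small for `m` equations in `k + 1`
variables at the origin.

The degree bound is a Bézout inequality proved by counting. Isolated points of linear sections give
systems of parameters `(f, ℓ)`. Their analytic independence provides multipliers `u_i` for which the
products of `u_i` with monomials in `f` and `ℓ_i` are linearly independent. Comparing the number of
such products with the number of monomials of degree at most `T + c` bounds the number of points by
the product of the `d_j`.

Results over the algebraic closure descend to the base field because the extension of polynomial
rings is free and integral: faithful flatness handles radicality, going down and integrality handle
components and dimensions. -/

namespace AffineVariety

/-! ### Depth, exchange of regular elements, and chains of primes -/

section Depth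

variable {A : Type*} [CommRing A]

/-- `x` is a nonzerodivisor modulo the ideal `J`. -/
def RegularMod (J : Ideal A) (x : A) : Prop := ∀ a, x * a ∈ J → a ∈ J

/-- `𝔪` contains a sequence of length `n` which is regular modulo `J`. -/
def HasDepth (𝔪 : Ideal A) : ℕ → Ideal A → Prop
  | 0, _ => True
  | n + 1, J => ∃ x ∈ 𝔪, RegularMod J x ∧ HasDepth 𝔪 n (J ⊔ Ideal.span {x})

theorem mem_sup_span_singleton {J : Ideal A} {x a : A} :
    a ∈ J ⊔ Ideal.span {x} ↔ ∃ c, a - x * c ∈ J := by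
  rw [Submodule.mem_sup]
  constructor
  · rintro ⟨j, hj, y, hy, rfl⟩
    obtain ⟨c, rfl⟩ := Ideal.mem_span_singleton'.1 hy
    exact ⟨c, by ring_nf; exact hj⟩
  · rintro ⟨c, hc⟩
    exact ⟨_, hc, x * c, Ideal.mem_span_singleton.2 ⟨c, rfl⟩, by ring⟩

/-- If `x a ≡ z b` modulo `J`, regularity of `z` modulo `J + (x)` gives `b ≡ x c`; cancelling `x`
from `x (a - z c)` leaves `a ≡ z c`. -/
theorem RegularMod.swap {J : Ideal A} {x z : A} (hx : RegularMod J x)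
    (hz : RegularMod (J ⊔ Ideal.span {x}) z) :
    RegularMod (J ⊔ Ideal.span {z}) x := by
  intro a ha
  obtain ⟨b, hb⟩ := mem_sup_span_singleton.1 ha
  have h1 : z * b ∈ J ⊔ Ideal.span {x} :=
    mem_sup_span_singleton.2 ⟨a, by simpa using J.neg_mem hb⟩
  obtain ⟨c, hc⟩ := mem_sup_span_singleton.1 (hz b h1)
  refine mem_sup_span_singleton.2 ⟨c, hx _ ?_⟩
  have : x * (a - z * c) = (x * a - z * b) + z * (b - x * c) := by ring
  rw [this]
  exact J.add_mem hb (J.mul_mem_left _ hc)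

/-- The relation `x u ≡ y v` modulo `J` carries a socle element `u` modulo `J + (y)` to a socle
element `v` modulo `J + (x)`, and `u` is trivial once `v` is. This is the elementary form of
computing the first Ext of the residue field with either regular element. -/
theorem socle_exchange {𝔪 J : Ideal A} {x y : A} (hx : RegularMod J x) (hy : RegularMod J y)
    (h : ∀ u, (∀ a ∈ 𝔪, a * u ∈ J ⊔ Ideal.span {x}) → u ∈ J ⊔ Ideal.span {x}) (hx𝔪 : x ∈ 𝔪) :
    ∀ u, (∀ a ∈ 𝔪, a * u ∈ J ⊔ Ideal.span {y}) → u ∈ J ⊔ Ideal.span {y} := by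
  intro u hu
  obtain ⟨v, hv⟩ := mem_sup_span_singleton.1 (hu x hx𝔪)
  have h1 : v ∈ J ⊔ Ideal.span {x} := by
    refine h v fun a ha => ?_
    obtain ⟨w, hw⟩ := mem_sup_span_singleton.1 (hu a ha)
    refine mem_sup_span_singleton.2 ⟨w, hy _ ?_⟩
    have : y * (a * v - x * w) = x * (a * u - y * w) - a * (x * u - y * v) := by ring
    rw [this]
    exact J.sub_mem (J.mul_mem_left _ hw) (J.mul_mem_left _ hv)
  obtain ⟨w, hw⟩ := mem_sup_span_singleton.1 h1
  refine mem_sup_span_singleton.2 ⟨w, hx _ ?_⟩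
  have : x * (u - y * w) = (x * u - y * v) + y * (v - x * w) := by ring
  rw [this]
  exact J.add_mem hv (J.mul_mem_left _ hw)

theorem RegularMod.socle {𝔪 J : Ideal A} {x : A} (hx𝔪 : x ∈ 𝔪) (hx : RegularMod J x) (u : A)
    (hu : ∀ a ∈ 𝔪, a * u ∈ J) : u ∈ J := hx u (hu x hx𝔪)

variable [IsNoetherianRing A]

/-- Prime avoidance over the associated primes of all the `A / J i`: one of them containing `𝔪`
would be the annihilator of a nonzero socle element. -/
theorem exists_regularMod {ι : Type*} [Finite ι] {𝔪 : Ideal A} [𝔪.IsMaximal]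
    (J : ι → Ideal A) (h : ∀ i u, (∀ a ∈ 𝔪, a * u ∈ J i) → u ∈ J i) :
    ∃ z ∈ 𝔪, ∀ i, RegularMod (J i) z := by
  classical
  have fin : (⋃ i, associatedPrimes A (A ⧸ J i)).Finite :=
    Set.finite_iUnion fun i => associatedPrimes.finite A (A ⧸ J i)
  have key : ¬ ((𝔪 : Set A) ⊆ ⋃ P ∈ ⋃ i, associatedPrimes A (A ⧸ J i), (id P : Ideal A)) := by
    rw [Ideal.subset_union_prime_finite fin 0 0]
    · rintro ⟨P, hP, hle⟩
      obtain ⟨i, hi⟩ := Set.mem_iUnion.1 hP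
      obtain ⟨hprime, x, hx⟩ := (isAssociatedPrime_iff (R := A)).1 hi
      obtain ⟨u, rfl⟩ := Ideal.Quotient.mk_surjective x
      have hu : u ∈ J i := by
        refine h i u fun a ha => ?_
        have := hle ha
        simp only [id] at this
        rw [hx, Submodule.mem_colon_singleton] at this
        rw [← Ideal.Quotient.eq_zero_iff_mem, map_mul]
        simpa [Algebra.smul_def] using this
      apply hprime.ne_top
      rw [hx, Ideal.Quotient.eq_zero_iff_mem.2 hu]
      simp
    · intro P hP _ _
      obtain ⟨i, hi⟩ := Set.mem_iUnion.1 hP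
      exact IsAssociatedPrime.isPrime hi
  obtain ⟨z, hz, hz'⟩ := Set.not_subset.1 key
  refine ⟨z, hz, fun i a ha => ?_⟩
  by_contra hcon
  apply hz'
  have : z ∈ ⋃ p ∈ associatedPrimes A (A ⧸ J i), (p : Set A) := by
    rw [biUnion_associatedPrimes_eq_zero_divisors]
    refine ⟨Ideal.Quotient.mk _ a, fun h0 => hcon (Ideal.Quotient.eq_zero_iff_mem.1 h0), ?_⟩
    rw [← Ideal.Quotient.eq_zero_iff_mem, map_mul] at ha
    simpa [Algebra.smul_def] using ha
  obtain ⟨p, hp, hzp⟩ := Set.mem_iUnion₂.1 this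
  exact Set.mem_iUnion₂.2 ⟨p, Set.mem_iUnion.2 ⟨i, hp⟩, hzp⟩

/-- Depth drops by one along any regular element of `𝔪`, not only the one in the given sequence. An
element `z` regular modulo both `J + (x)` and `J + (y)` links the two: the induction hypothesis
passes from `x` to `z`, and then, after swapping, from `z` to `y`. -/
theorem HasDepth.sup_span_singleton {𝔪 : Ideal A} [𝔪.IsMaximal] {n : ℕ} {J : Ideal A}
    (hJ : HasDepth 𝔪 (n + 1) J) {y : A} (hy𝔪 : y ∈ 𝔪) (hy : RegularMod J y) :
    HasDepth 𝔪 n (J ⊔ Ideal.span {y}) := by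
  induction n generalizing J y with
  | zero => trivial
  | succ n ih =>
    obtain ⟨x, hx𝔪, hx, hJx⟩ := hJ
    have hs : ∀ u, (∀ a ∈ 𝔪, a * u ∈ J ⊔ Ideal.span {x}) → u ∈ J ⊔ Ideal.span {x} := by
      obtain ⟨x', hx'𝔪, hx', -⟩ := hJx
      exact hx'.socle hx'𝔪
    have hs' := socle_exchange hx hy hs hx𝔪
    obtain ⟨z, hz𝔪, hz⟩ := exists_regularMod (𝔪 := 𝔪)
      ![J ⊔ Ideal.span {x}, J ⊔ Ideal.span {y}] (by
        intro i
        fin_cases i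
        · exact hs
        · exact hs')
    have hzx : RegularMod (J ⊔ Ideal.span {x}) z := hz 0
    have hzy : RegularMod (J ⊔ Ideal.span {y}) z := hz 1
    have h1 := ih hJx hz𝔪 hzx
    rw [sup_right_comm] at h1
    have h2 := ih ⟨x, hx𝔪, hx.swap hzx, h1⟩ hy𝔪 (hy.swap hzy)
    rw [sup_right_comm] at h2
    exact ⟨z, hz𝔪, hzy, h2⟩

/-- The determinant trick, for an ideal `N` with `s N ⊆ J + x N`. -/
theorem exists_pow_sub_mul_mem {J N : Ideal A} {s x : A}
    (h : ∀ v ∈ N, ∃ w ∈ N, s * v - x * w ∈ J) :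
    ∃ n : ℕ, ∃ r : A, ∀ v ∈ N, (s ^ n - x * r) * v ∈ J := by
  classical
  obtain ⟨n, g, hg⟩ := Submodule.fg_iff_exists_fin_generating_family.1
    (IsNoetherian.noetherian N)
  have hgN : ∀ i, g i ∈ N := fun i => hg ▸ Submodule.subset_span ⟨i, rfl⟩
  have hc : ∀ i, ∃ c : Fin n → A, s * g i - x * ∑ j, c j * g j ∈ J := by
    intro i
    obtain ⟨w, hw, hw'⟩ := h _ (hgN i)
    rw [← hg] at hw
    obtain ⟨c, rfl⟩ := (Submodule.mem_span_range_iff_exists_fun A).1 hw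
    exact ⟨c, hw'⟩
  choose c hc using hc
  let M : Matrix (Fin n) (Fin n) A := Matrix.of fun i j => (if i = j then s else 0) - x * c i j
  have hM : ∀ i, M.mulVec g i ∈ J := by
    intro i
    convert hc i using 1
    simp [M, Matrix.mulVec, dotProduct, sub_mul, Finset.sum_sub_distrib, Finset.mul_sum, mul_assoc]
  have hdet : ∀ i, M.det * g i ∈ J := by
    intro i
    have : M.det * g i = (M.adjugate.mulVec (M.mulVec g)) i := by
      rw [Matrix.mulVec_mulVec, Matrix.adjugate_mul]
      simp [Matrix.smul_mulVec]
    rw [this, Matrix.mulVec, dotProduct]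
    exact J.sum_mem fun j _ => J.mul_mem_left _ (hM j)
  have hmod : s ^ n - M.det ∈ Ideal.span {x} := by
    rw [← Ideal.Quotient.eq_zero_iff_mem, map_sub, sub_eq_zero, RingHom.map_det, map_pow]
    have : (Ideal.Quotient.mk (Ideal.span {x})).mapMatrix M =
        Matrix.diagonal fun _ => Ideal.Quotient.mk (Ideal.span {x}) s := by
      ext i j
      have hx : Ideal.Quotient.mk (Ideal.span {x}) x = 0 :=
        Ideal.Quotient.eq_zero_iff_mem.2 (Ideal.mem_span_singleton_self x)
      by_cases hij : i = j
      · subst hij; simp [M, hx]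
      · simp [M, hx, hij]
    rw [this]
    simp
  obtain ⟨r, hr⟩ := Ideal.mem_span_singleton'.1 hmod
  refine ⟨n, r, fun v hv => ?_⟩
  have h1 : s ^ n - x * r = M.det := by rw [mul_comm x, hr]; ring
  rw [h1]
  rw [← hg] at hv
  obtain ⟨c', rfl⟩ := (Submodule.mem_span_range_iff_exists_fun A).1 hv
  rw [Finset.mul_sum]
  refine J.sum_mem fun i _ => ?_
  have : M.det * (c' i • g i) = c' i * (M.det * g i) := by simp only [smul_eq_mul]; ring
  rw [this]
  exact J.mul_mem_left _ (hdet i)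

/-- If `P` is associated to `A / J` and `𝔪 ⊇ P` has depth at least `n` modulo `J`, then there is a
chain of primes of length `n` between `P` and `𝔪`. -/
theorem HasDepth.exists_ltSeries {𝔪 : Ideal A} [h𝔪 : 𝔪.IsPrime] {n : ℕ} {J : Ideal A}
    (hJ : HasDepth 𝔪 n J) {P : Ideal A} (hP : P.IsPrime) {u : A} (hu : ∀ a, a ∈ P ↔ a * u ∈ J)
    (hP𝔪 : P ≤ 𝔪) :
    ∃ l : LTSeries (PrimeSpectrum A), l.length = n ∧ l.head = ⟨P, hP⟩ ∧
      l.last.asIdeal ≤ 𝔪 := by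
  induction n generalizing J P u with
  | zero => exact ⟨RelSeries.singleton _ ⟨P, hP⟩, rfl, rfl, hP𝔪⟩
  | succ n ih =>
    obtain ⟨x, hx𝔪, hx, hJx⟩ := hJ
    -- A Nakayama argument for `N = J : P`. If no such `v` exists, some `s ∉ 𝔪` satisfies `s N ⊆ J +
    -- x N`, and the determinant trick produces an element `s ^ k - x r` that annihilates `u` modulo
    -- `J`. It lies in `P ⊆ 𝔪`, which forces `s ∈ 𝔪`.
    obtain ⟨v, hPv, hv⟩ : ∃ v, (∀ p ∈ P, p * v ∈ J) ∧
        ∀ a, a * v ∈ J ⊔ Ideal.span {x} → a ∈ 𝔪 := by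
      by_contra hcon
      push Not at hcon
      let N : Ideal A := J.colon (P : Set A)
      have hN : ∀ v, v ∈ N ↔ ∀ p ∈ P, p * v ∈ J := fun v => by
        simp [N, Submodule.mem_colon, mul_comm]
      obtain ⟨s, hs𝔪, hs⟩ : ∃ s ∉ 𝔪, ∀ v ∈ N, s * v ∈ J ⊔ Ideal.span {x} := by
        obtain ⟨k, g, hg⟩ := Submodule.fg_iff_exists_fin_generating_family.1
          (IsNoetherian.noetherian N)
        have : ∀ i, ∃ a, a * g i ∈ J ⊔ Ideal.span {x} ∧ a ∉ 𝔪 := fun i =>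
          hcon (g i) ((hN _).1 (hg ▸ Submodule.subset_span ⟨i, rfl⟩))
        choose a ha ha' using this
        refine ⟨∏ i, a i, fun hmem => ?_, fun v hv => ?_⟩
        · obtain ⟨i, -, hi⟩ := h𝔪.prod_mem_iff.1 hmem
          exact ha' i hi
        · rw [← hg] at hv
          obtain ⟨c, rfl⟩ := (Submodule.mem_span_range_iff_exists_fun A).1 hv
          rw [Finset.mul_sum]
          refine Ideal.sum_mem _ fun i _ => ?_
          obtain ⟨b, hb⟩ := Finset.dvd_prod_of_mem a (Finset.mem_univ i)
          have : (∏ i, a i) * c i • g i = (b * c i) * (a i * g i) := by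
            rw [hb, smul_eq_mul]; ring
          rw [this]
          exact Ideal.mul_mem_left _ _ (ha i)
      obtain ⟨k, r, hr⟩ := exists_pow_sub_mul_mem (J := J) (N := N) (s := s) (x := x) (by
        intro v hv
        obtain ⟨w, hw⟩ := mem_sup_span_singleton.1 (hs v hv)
        refine ⟨w, (hN w).2 fun p hp => hx _ ?_, hw⟩
        have : x * (p * w) = s * (p * v) - p * (s * v - x * w) := by ring
        rw [this]
        exact J.sub_mem (J.mul_mem_left _ ((hN v).1 hv p hp)) (J.mul_mem_left _ hw))
      have huN : u ∈ N := (hN u).2 fun p hp => (hu p).1 hp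
      have h1 : s ^ k - x * r ∈ 𝔪 := hP𝔪 ((hu _).2 (hr u huN))
      have h2 : s ^ k ∈ 𝔪 := by
        simpa using 𝔪.add_mem h1 (𝔪.mul_mem_right r hx𝔪)
      exact hs𝔪 (h𝔪.mem_of_pow_mem _ h2)
    have hle : (J ⊔ Ideal.span {x}).colon {v} ≤ 𝔪 := fun a ha =>
      hv a (by simpa using Submodule.mem_colon_singleton.1 ha)
    obtain ⟨Q, hQ, hQ𝔪⟩ := Ideal.exists_minimalPrimes_le hle
    obtain ⟨w, hw⟩ := Submodule.exists_eq_colon_of_mem_minimalPrimes hQ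
    have hQp : Q.IsPrime := hQ.1.1
    obtain ⟨l, hl, hhead, hlast⟩ := ih hJx hQp (u := w)
      (fun a => by rw [hw, Submodule.mem_colon_singleton, smul_eq_mul]) hQ𝔪
    have hPQ : (⟨P, hP⟩ : PrimeSpectrum A) < ⟨Q, hQp⟩ := by
      refine lt_of_le_of_ne (fun p hp => hQ.1.2 ?_) fun heq => ?_
      · rw [Submodule.mem_colon_singleton]
        exact Ideal.mem_sup_left (hPv p hp)
      -- The inclusion is strict because `x ∈ Q`, whereas the annihilator `P` of `u` cannot contain
      -- an element regular modulo `J`.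
      · have hxQ : x ∈ Q := hQ.1.2 (by
          rw [Submodule.mem_colon_singleton]
          exact Ideal.mem_sup_right (Ideal.mul_mem_right _ _ (Ideal.mem_span_singleton_self x)))
        have hPQ' : P = Q := congrArg PrimeSpectrum.asIdeal heq
        rw [← hPQ', hu] at hxQ
        apply hP.ne_top
        rw [Ideal.eq_top_iff_one, hu, one_mul]
        exact hx u hxQ
    refine ⟨l.cons ⟨P, hP⟩ (by rw [hhead]; exact hPQ), by simp [hl], by simp, by simpa using hlast⟩

end Depth

end AffineVariety


namespace AffineVariety

/-! ### Analytic independence of systems of parameters -/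

section AnalyticIndependence

open MvPolynomial

theorem eval_sub_eval_mem {R σ : Type*} [CommRing R] {I : Ideal R} {x y : σ → R}
    (h : ∀ i, x i - y i ∈ I) (p : MvPolynomial σ R) : eval x p - eval y p ∈ I := by
  rw [← Ideal.Quotient.eq_zero_iff_mem, map_sub, sub_eq_zero]
  have : (fun i => Ideal.Quotient.mk I (x i)) = fun i => Ideal.Quotient.mk I (y i) := by
    ext i
    rw [← sub_eq_zero, ← map_sub, Ideal.Quotient.eq_zero_iff_mem]
    exact h i
  rw [← eval₂_id, ← eval₂_id, hom_eval₂, hom_eval₂]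
  simp only [this]

/-- If `p` has no term of degree less than `n`, then `p (s c) = s ^ n (pₙ (c) + s r)`, where `pₙ` is
the homogeneous component of degree `n`. -/
theorem exists_eval_mul_eq {R σ : Type*} [CommRing R] {p : MvPolynomial σ R} {n : ℕ}
    (hp : ∀ b, b.degree < n → coeff b p = 0) (c : σ → R) (s : R) :
    ∃ r, eval (fun i => c i * s) p = s ^ n * (eval c (homogeneousComponent n p) + s * r) := by
  classical
  have h1 : ∀ q : MvPolynomial σ R, ∀ j, q.IsHomogeneous j →
      eval (fun i => c i * s) q = s ^ j * eval c q := by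
    intro q j hq
    rw [eval_eq, eval_eq, Finset.mul_sum]
    refine Finset.sum_congr rfl fun b hb => ?_
    have hd : ∑ i ∈ b.support, b i = j := by
      have := hq (mem_support_iff.1 hb)
      rwa [Pi.one_def, ← Finsupp.degree_eq_weight_one, Finsupp.degree_apply] at this
    simp only [mul_pow, Finset.prod_mul_distrib, Finset.prod_pow_eq_pow_sum, hd]
    ring
  have h0 : ∀ j < n, homogeneousComponent j p = 0 := by
    intro j hj
    ext b
    rw [coeff_homogeneousComponent, coeff_zero]
    split_ifs with h
    · exact hp b (h ▸ hj)
    · rfl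
  refine ⟨∑ j ∈ Finset.Ico (n + 1) (p.totalDegree + n + 2),
    s ^ (j - (n + 1)) * eval c (homogeneousComponent j p), ?_⟩
  have hsum : p = ∑ j ∈ Finset.range (p.totalDegree + n + 2), homogeneousComponent j p := by
    conv_lhs => rw [← sum_homogeneousComponent p]
    refine Finset.sum_subset (Finset.range_mono (by omega)) fun j _ hj => ?_
    exact homogeneousComponent_eq_zero _ _ (by simpa using hj)
  conv_lhs => rw [hsum]
  rw [map_sum, Finset.range_eq_Ico,
    ← Finset.sum_Ico_consecutive _ (Nat.zero_le n) (by omega : n ≤ p.totalDegree + n + 2),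
    Finset.sum_eq_zero (fun j hj => by rw [h0 j (Finset.mem_Ico.1 hj).2, map_zero]), zero_add,
    Finset.sum_eq_sum_Ico_succ_bot (by omega), h1 _ n (homogeneousComponent_isHomogeneous n p),
    mul_add, Finset.mul_sum, Finset.mul_sum]
  congr 1
  refine Finset.sum_congr rfl fun j hj => ?_
  have hj' := (Finset.mem_Ico.1 hj).1
  rw [h1 _ j (homogeneousComponent_isHomogeneous j p), ← mul_assoc, ← mul_assoc]
  congr 1
  rw [← pow_succ, ← pow_add]
  congr 1
  omega

/-- A system of parameters is analytically independent: if `p (h) = 0`, where `h` is a sequence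
of `e ≤ ht Q` elements over which the prime `Q` is minimal, then the coefficients of the lowest
homogeneous component of `p` are in `Q`. -/
theorem coeff_mem_of_eval_eq_zero (Ω : Type*) [Field Ω] [Infinite Ω] {R : Type*} [CommRing R]
    [IsNoetherianRing R] [Algebra Ω R] {e : ℕ} {h : Fin e → R} {Q : Ideal R}
    (hQ : Q ∈ (Ideal.span (Set.range h)).minimalPrimes) (he : (e : ℕ∞) ≤ Q.height)
    {p : MvPolynomial (Fin e) R} (hp : eval h p = 0) {n : ℕ}
    (hn : ∀ b, b.degree < n → coeff b p = 0) {b : Fin e →₀ ℕ} (hb : b.degree = n) :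
    coeff b p ∈ Q := by
  classical
  have hQp : Q.IsPrime := hQ.1.1
  by_contra hbQ
  rcases Nat.eq_zero_or_pos e with rfl | hepos
  · have : p = C (coeff b p) := by
      rw [Subsingleton.elim b 0]
      exact eq_C_of_isEmpty p
    rw [this, eval_C] at hp
    exact hbQ (hp ▸ Q.zero_mem)
  let j₀ : Fin e := ⟨0, hepos⟩
  let φ := Ideal.Quotient.mk Q
  let ψ : Ω →+* R ⧸ Q := φ.comp (algebraMap Ω R)
  -- The extra factor `X j₀` ensures that a point `c` where `q` does not vanish has `c j₀ ≠ 0`.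
  let q : MvPolynomial (Fin e) (R ⧸ Q) := map φ (homogeneousComponent n p) * X j₀
  have hq : q ≠ 0 := by
    refine mul_ne_zero (fun h0 => hbQ ?_) (X_ne_zero j₀)
    have := congrArg (coeff b) h0
    rwa [coeff_map, coeff_homogeneousComponent, if_pos hb, coeff_zero,
      Ideal.Quotient.eq_zero_iff_mem] at this
  obtain ⟨c, hc⟩ : ∃ c : Fin e → Ω, eval (fun i => ψ (c i)) q ≠ 0 := by
    by_contra hcon
    push Not at hcon
    apply hq
    refine funext_set (fun _ => Set.range ψ)
      (fun _ => Set.infinite_range_of_injective ψ.injective) fun x hx => ?_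
    choose c hc using fun i => hx i (Set.mem_univ i)
    have : x = fun i => ψ (c i) := funext fun i => (hc i).symm
    rw [this, hcon c, map_zero]
  have hc0 : c j₀ ≠ 0 := by
    intro h0
    apply hc
    simp [q, h0]
  have hcQ : eval (fun i => algebraMap Ω R (c i)) (homogeneousComponent n p) ∉ Q := by
    intro hmem
    apply hc
    have : eval (fun i => ψ (c i)) (map φ (homogeneousComponent n p)) =
        φ (eval (fun i => algebraMap Ω R (c i)) (homogeneousComponent n p)) := by
      rw [eval_map, ← eval₂_id, hom_eval₂]
      rfl
    rw [map_mul, this, Ideal.Quotient.eq_zero_iff_mem.2 hmem, zero_mul]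
  -- Modulo the `g j = h j - c j * s`, of which `g j₀` is zero, the relation becomes `s ^ n * (pₙ(c)
  -- + s r) = 0` with the second factor outside `Q`. So a prime below `Q` containing the `g j`
  -- contains `s` and every `h j`. Thus `Q` is minimal over `e - 1` elements, against Krull's height
  -- theorem.
  let s : R := algebraMap Ω R (c j₀)⁻¹ * h j₀
  let g : Fin e → R := fun j => h j - algebraMap Ω R (c j) * s
  have hg0 : g j₀ = 0 := by
    simp only [g, s]
    rw [← mul_assoc, ← map_mul, mul_inv_cancel₀ hc0, map_one, one_mul, sub_self]
  have hhQ : ∀ j, h j ∈ Q := fun j => hQ.1.2 (Ideal.subset_span ⟨j, rfl⟩)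
  have hsQ : s ∈ Q := Q.mul_mem_left _ (hhQ j₀)
  have hgQ : ∀ j, g j ∈ Q := fun j => Q.sub_mem (hhQ j) (Q.mul_mem_left _ hsQ)
  let S : Set R := g '' {j | j ≠ j₀}
  have hgS : ∀ j, g j ∈ Ideal.span S := by
    intro j
    by_cases hj : j = j₀
    · rw [hj, hg0]; exact Ideal.zero_mem _
    · exact Ideal.subset_span ⟨j, hj, rfl⟩
  obtain ⟨r, hr⟩ := exists_eval_mul_eq hn (fun i => algebraMap Ω R (c i)) s
  have hmin : Q ∈ (Ideal.span S).minimalPrimes := by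
    refine ⟨⟨hQp, Ideal.span_le.2 ?_⟩, ?_⟩
    · rintro _ ⟨j, -, rfl⟩
      exact hgQ j
    · rintro Q' ⟨hQ'p, hSQ'⟩ hQ'Q
      have h1 : eval h p - eval (fun i => algebraMap Ω R (c i) * s) p ∈ Q' :=
        eval_sub_eval_mem (fun j => hSQ' (hgS j)) p
      rw [hp, zero_sub, neg_mem_iff, hr] at h1
      have hs : s ∈ Q' := by
        rcases hQ'p.mem_or_mem h1 with h2 | h2
        · exact hQ'p.mem_of_pow_mem _ h2
        · exact absurd ((Ideal.add_mem_iff_left _ (Q.mul_mem_right _ hsQ)).1 (hQ'Q h2)) hcQ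
      refine hQ.2 ⟨hQ'p, Ideal.span_le.2 ?_⟩ hQ'Q
      rintro _ ⟨j, rfl⟩
      have := Q'.add_mem (hSQ' (hgS j)) (Q'.mul_mem_left (algebraMap Ω R (c j)) hs)
      simpa [g] using this
  have hcard : S.ncard ≤ e - 1 := by
    refine (Set.ncard_image_le (Set.toFinite _)).trans ?_
    rw [Set.ncard_eq_toFinset_card']
    have : ({j | j ≠ j₀} : Set (Fin e)).toFinset = Finset.univ.erase j₀ := by
      ext; simp
    rw [this, Finset.card_erase_of_mem (Finset.mem_univ _)]
    simp
  have := he.trans (Ideal.height_le_card_of_mem_minimalPrimes_span (Set.toFinite S) hmin)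
  have h2 : e ≤ S.ncard := by exact_mod_cast this
  omega

/-- A version of analytic independence for coefficients in a set which meets an intersection of
primes only in `0`. -/
theorem eq_zero_of_eval_eq_zero (Ω : Type*) [Field Ω] [Infinite Ω] {R : Type*} [CommRing R]
    [IsNoetherianRing R] [Algebra Ω R] {e : ℕ} {h : Fin e → R} {ι : Sort*} {Q : ι → Ideal R}
    (hQ : ∀ i, Q i ∈ (Ideal.span (Set.range h)).minimalPrimes) (he : ∀ i, (e : ℕ∞) ≤ (Q i).height)
    {p : MvPolynomial (Fin e) R} (hp : eval h p = 0)
    (hcoeff : ∀ b, (∀ i, coeff b p ∈ Q i) → coeff b p = 0) : p = 0 := by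
  have : ∀ n, ∀ b : Fin e →₀ ℕ, b.degree = n → coeff b p = 0 := by
    intro n
    induction n using Nat.strong_induction_on with
    | _ n ih =>
      intro b hb
      exact hcoeff b fun i =>
        coeff_mem_of_eval_eq_zero Ω (hQ i) (he i) hp (fun b' hb' => ih _ hb' b' rfl) hb
  ext b
  rw [this _ b rfl, coeff_zero]

end AnalyticIndependence

/-! ### The coordinates at a point form a regular sequence -/

section Points

open MvPolynomial

variable {K : Type*} [Field K]

theorem ker_eval_add_le {k : ℕ} (x : Fin k → K) (i : ℕ) (p : MvPolynomial (Fin k) K) :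
    p - aeval (fun j : Fin k => if (j : ℕ) < i then C (x j) else X j) p ∈
      Ideal.span ((fun j : Fin k => X j - C (x j) : Fin k → MvPolynomial (Fin k) K) ''
        {j | (j : ℕ) < i}) := by
  set I := Ideal.span ((fun j : Fin k => X j - C (x j) : Fin k → MvPolynomial (Fin k) K) ''
        {j | (j : ℕ) < i})
  have := eval_sub_eval_mem (I := I) (x := X)
    (y := (fun j : Fin k => if (j : ℕ) < i then C (x j) else X j)) (fun j => by
      split_ifs with h
      · exact Ideal.subset_span ⟨j, h, rfl⟩
      · simp) (map C p)
  rw [eval_map, eval_map] at this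
  rw [aeval_def, algebraMap_eq]
  rwa [eval₂_eta] at this

/-- Substituting `x j` for the variables before `i` has the given ideal as kernel and lands in a
domain, where `X i - x i` is nonzero and left unchanged by the substitution. -/
theorem regularMod_X_sub_C {k : ℕ} (x : Fin k → K) (i : Fin k) :
    RegularMod (Ideal.span ((fun j : Fin k => X j - C (x j) : Fin k → MvPolynomial (Fin k) K) ''
        {j | (j : ℕ) < i})) (X i - C (x i)) := by
  set I := Ideal.span ((fun j : Fin k => X j - C (x j) : Fin k → MvPolynomial (Fin k) K) ''
        {j | (j : ℕ) < i})
  let θ := aeval (R := K) (fun j : Fin k => if (j : ℕ) < i then C (x j) else X j)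
    (S₁ := MvPolynomial (Fin k) K)
  have hI : ∀ a ∈ I, θ a = 0 := by
    intro a ha
    have : I ≤ RingHom.ker θ := by
      refine Ideal.span_le.2 ?_
      rintro _ ⟨j, hj, rfl⟩
      have hj' : (j : ℕ) < i := hj
      simp [θ, RingHom.mem_ker, hj', -Fin.val_fin_lt]
    exact this ha
  intro a ha
  have h1 := hI _ ha
  have h2 : θ (X i - C (x i)) = X i - C (x i) := by simp [θ]
  have h3 : (X i - C (x i) : MvPolynomial (Fin k) K) ≠ 0 := by
    intro h0
    have := congrArg (coeff (Finsupp.single i 1)) h0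
    have h5 : (0 : Fin k →₀ ℕ) ≠ Finsupp.single i 1 := by simp [Finsupp.ext_iff, Finsupp.single_apply]
    simp [coeff_C, h5] at this
  rw [map_mul, h2] at h1
  have h4 : θ a = 0 := (mul_eq_zero.1 h1).resolve_left h3
  have h5 := ker_eval_add_le x i a
  change a - θ a ∈ I at h5
  rwa [h4, sub_zero] at h5

theorem hasDepth_vanishingIdeal {k : ℕ} (x : Fin k → K) :
    HasDepth (vanishingIdeal K {x}) k (⊥ : Ideal (MvPolynomial (Fin k) K)) := by
  have : ∀ n i : ℕ, i + n = k → HasDepth (vanishingIdeal K {x}) n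
      (Ideal.span ((fun j : Fin k => X j - C (x j) : Fin k → MvPolynomial (Fin k) K) ''
        {j | (j : ℕ) < i})) := by
    intro n
    induction n with
    | zero => intro i _; trivial
    | succ n ih =>
      intro i hi
      let i' : Fin k := ⟨i, by omega⟩
      refine ⟨X i' - C (x i'), ?_, regularMod_X_sub_C x i', ?_⟩
      · simp
      · convert ih (i + 1) (by omega) using 1
        rw [← Ideal.span_union]
        congr 1
        have : {j : Fin k | (j : ℕ) < i + 1} = {j : Fin k | (j : ℕ) < i} ∪ {i'} := by
          ext j
          simp only [Set.mem_ofPred_eq, Set.mem_union, Set.mem_singleton_iff, i', Fin.ext_iff]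
          omega
        rw [this, Set.image_union, Set.image_singleton]
  have h := this k 0 (by omega)
  simpa using h

end Points

end AffineVariety


/-! ### Dimension and transcendence degree -/

namespace AffineVariety

open MvPolynomial

theorem ringKrullDim_le_of_isIntegral {R S : Type*} [CommRing R] [CommRing S] (g : R →+* S)
    (hg : g.IsIntegral) : ringKrullDim S ≤ ringKrullDim R := by
  algebraize [g]
  refine Order.krullDim_le_of_strictMono (PrimeSpectrum.comap (algebraMap R S)) fun p q hpq => ?_
  have : p.asIdeal < q.asIdeal := hpq
  exact Ideal.IsIntegral.comap_lt_comap this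

section FractionField

variable {K : Type*} [Field K] {k : ℕ} {P : Ideal (MvPolynomial (Fin k) K)}
  {F : Type*} [Field F] [Algebra K F] [Algebra (MvPolynomial (Fin k) K ⧸ P) F]
  [IsScalarTower K (MvPolynomial (Fin k) K ⧸ P) F] [IsFractionRing (MvPolynomial (Fin k) K ⧸ P) F]

theorem isAlgebraic_of_forall_X (T : Set F) (hT : ∀ i, IsAlgebraic (IntermediateField.adjoin K T)
      (algebraMap (MvPolynomial (Fin k) K ⧸ P) F (Ideal.Quotient.mk P (X i)))) :
    Algebra.IsAlgebraic (Algebra.adjoin K T) F := by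
  let A := MvPolynomial (Fin k) K ⧸ P
  let E := IntermediateField.adjoin K T
  have hA : ∀ a : A, algebraMap A F a ∈ algebraicClosure E F := by
    intro a
    obtain ⟨p, rfl⟩ := Ideal.Quotient.mk_surjective a
    let φ : MvPolynomial (Fin k) K →ₐ[K] F :=
      (IsScalarTower.toAlgHom K A F).comp (Ideal.Quotient.mkₐ K P)
    change φ p ∈ _
    induction p using MvPolynomial.induction_on with
    | C c =>
      have : φ (C c) = algebraMap E F (algebraMap K E c) := by
        rw [← algebraMap_eq, AlgHom.commutes, ← IsScalarTower.algebraMap_apply]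
      rw [this]
      exact IntermediateField.algebraMap_mem _ _
    | add p q hp hq => rw [map_add]; exact add_mem hp hq
    | mul_X p i hp => rw [map_mul]; exact mul_mem hp (mem_algebraicClosure_iff.2 (hT i))
  have halg : Algebra.IsAlgebraic E F := by
    refine ⟨fun z => ?_⟩
    obtain ⟨a, b, hb, rfl⟩ := IsFractionRing.div_surjective (A := A) z
    exact mem_algebraicClosure_iff.1 (div_mem (hA a) (hA b))
  rwa [← IntermediateField.isAlgebraic_adjoin_iff_top]

/-- Noether normalization: `s` is the number of variables of a polynomial subring over which the
quotient is integral, and these variables stay algebraically independent in `F`. -/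
theorem ringKrullDim_quotient_le_trdeg [P.IsPrime] :
    ∃ s : ℕ, ringKrullDim (MvPolynomial (Fin k) K ⧸ P) ≤ s ∧ (s : Cardinal) ≤ Algebra.trdeg K F := by
  let A := MvPolynomial (Fin k) K ⧸ P
  obtain ⟨s, g, hginj, hgint⟩ := exists_integral_inj_algHom_of_fg K A
  have hy : AlgebraicIndependent K fun i : Fin s => algebraMap A F (g (X i)) := by
    have h1 : AlgebraicIndependent K (X : Fin s → MvPolynomial (Fin s) K) :=
      algebraicIndependent_X _ _
    exact h1.map' (f := (IsScalarTower.toAlgHom K A F).comp g)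
      ((IsFractionRing.injective A F).comp hginj)
  refine ⟨s, ?_, by simpa using hy.lift_cardinalMk_le_trdeg⟩
  calc ringKrullDim A ≤ ringKrullDim (MvPolynomial (Fin s) K) :=
        ringKrullDim_le_of_isIntegral g.toRingHom hgint
    _ = s := by
        rw [MvPolynomial.ringKrullDim_of_isNoetherianRing, ringKrullDim_eq_zero_of_field]
        simp

/-- The dimension of `K[X] / P` is at most the number of elements of a finite subset of its fraction
field over which the coordinate functions are algebraic. -/
theorem ringKrullDim_quotient_le [P.IsPrime] (T : Finset F)
    (hT : ∀ i, IsAlgebraic (IntermediateField.adjoin K (T : Set F))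
      (algebraMap (MvPolynomial (Fin k) K ⧸ P) F (Ideal.Quotient.mk P (X i)))) :
    ringKrullDim (MvPolynomial (Fin k) K ⧸ P) ≤ T.card := by
  have := isAlgebraic_of_forall_X _ hT
  obtain ⟨t, ht, hbasis⟩ := exists_isTranscendenceBasis_subset (R := K) (T : Set F)
  obtain ⟨s, hs, hs'⟩ := ringKrullDim_quotient_le_trdeg (P := P) (F := F)
  rw [← hbasis.cardinalMk_eq_trdeg] at hs'
  have h2 : Cardinal.mk t ≤ T.card := by simpa using Cardinal.mk_le_mk_of_subset ht
  have h3 : s ≤ T.card := by exact_mod_cast hs'.trans h2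
  exact hs.trans (by exact_mod_cast h3)

/-- A generating family of the fraction field, up to algebraic extensions, which has at most
`dim K[X] / P` elements is algebraically independent. -/
theorem algebraicIndependent_of_card_le_ringKrullDim [P.IsPrime] {ι : Type*} [Fintype ι] (y : ι → F)
    (hy : ∀ i, IsAlgebraic (IntermediateField.adjoin K (Set.range y))
      (algebraMap (MvPolynomial (Fin k) K ⧸ P) F (Ideal.Quotient.mk P (X i))))
    (hdim : ((Fintype.card ι : ℕ) : WithBot ℕ∞) ≤ ringKrullDim (MvPolynomial (Fin k) K ⧸ P)) :
    AlgebraicIndependent K y := by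
  classical
  have := isAlgebraic_of_forall_X _ hy
  obtain ⟨t, ht, hbasis⟩ := exists_isTranscendenceBasis_subset (R := K) (Set.range y)
  obtain ⟨s, hs, hs'⟩ := ringKrullDim_quotient_le_trdeg (P := P) (F := F)
  rw [← hbasis.cardinalMk_eq_trdeg] at hs'
  have htfin : t.Finite := (Set.finite_range y).subset ht
  have h1 : Fintype.card ι ≤ s := by exact_mod_cast hdim.trans hs
  have h2 : s ≤ t.ncard := by
    rw [← Set.cast_ncard htfin] at hs'
    exact_mod_cast hs'
  have h3 : (Set.range y).ncard ≤ Fintype.card ι := by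
    rw [← Set.image_univ, ← Nat.card_eq_fintype_card, ← Set.ncard_univ]
    exact Set.ncard_image_le
  have h4 : t = Set.range y :=
    Set.eq_of_subset_of_ncard_le ht (h3.trans (h1.trans h2)) (Set.finite_range y)
  have hinj : Function.Injective y := by
    rw [← Set.injOn_univ]
    refine Set.injOn_of_ncard_image_eq ?_
    rw [Set.image_univ, Set.ncard_univ, Nat.card_eq_fintype_card]
    refine le_antisymm h3 ?_
    rw [← h4]
    exact h1.trans h2
  rw [← algebraicIndependent_subtype_range hinj]
  rw [← h4]
  exact hbasis.1

end FractionField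

/-- A matrix with linearly independent rows has an invertible maximal minor. -/
theorem exists_isUnit_det_submatrix {F : Type*} [Field F] {m k : ℕ} {M : Matrix (Fin m) (Fin k) F}
    (hM : LinearIndependent F M.row) :
    ∃ c : Fin m → Fin k, Function.Injective c ∧ IsUnit (M.submatrix id c).det := by
  classical
  have hspan : Submodule.span F (Set.range M.col) = ⊤ := by
    apply Submodule.eq_top_of_finrank_eq
    rw [← Matrix.rank_eq_finrank_span_cols, hM.rank_matrix]
    simp
  obtain ⟨κ, a, ha, hspan', hli⟩ := exists_linearIndependent' F M.col
  rw [hspan] at hspan'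
  have : Finite κ := Finite.of_injective a ha
  have := Fintype.ofFinite κ
  have hcard : Fintype.card κ = m := by
    have := Module.finrank_eq_card_basis (Module.Basis.mk hli hspan'.ge)
    simpa using this.symm
  let e : Fin m ≃ κ := (Fintype.equivFinOfCardEq hcard).symm
  refine ⟨a ∘ e, ha.comp e.injective, ?_⟩
  rw [← Matrix.isUnit_iff_isUnit_det, ← Matrix.linearIndependent_cols_iff_isUnit]
  exact hli.comp e e.injective

theorem formallyUnramified_of_forall_D_eq_zero {R S : Type*} [CommRing R] [CommRing S] [Algebra R S]
    (h : ∀ x, KaehlerDifferential.D R S x = 0) : Algebra.FormallyUnramified R S := by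
  refine ⟨subsingleton_of_forall_eq 0 fun y => ?_⟩
  have hy : y ∈ Submodule.span S (Set.range (KaehlerDifferential.D R S)) := by
    rw [KaehlerDifferential.span_range_derivation]
    trivial
  have : Submodule.span S (Set.range (KaehlerDifferential.D R S)) ≤ ⊥ := by
    rw [Submodule.span_le]
    rintro _ ⟨x, rfl⟩
    exact h x
  exact this hy

/-! ### The Jacobian dichotomy for diagonal systems -/

section Diagonal

variable {K : Type*} [Field K] {k m : ℕ} {d : Fin m → ℕ} {b : Fin m → K}

/-- Jacobian criterion: a derivation of an algebra in which the `f_j` vanish, and a maximal minor of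
the Jacobian matrix is a unit, is zero if it kills the coordinates outside of the minor. -/
theorem derivation_eq_zero {B M : Type*} [CommRing B] [Algebra K B] [AddCommGroup M] [Module K M]
    [Module B M] [IsScalarTower K B M] (φ : MvPolynomial (Fin k) K →ₐ[K] B)
    (hφ : ∀ j, φ (diagonal k d b j) = 0)
    (hfrac : ∀ x : B, ∃ p s, IsUnit (φ s) ∧ φ s * x = φ p)
    {c : Fin m → Fin k} (hc : Function.Injective c)
    (hdet : IsUnit (Matrix.of fun j j' : Fin m => (d j : B) * φ (X (c j')) ^ (d j - 1)).det)
    (D : Derivation K B M) (hD : ∀ i ∉ Set.range c, D (φ (X i)) = 0) : D = 0 := by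
  classical
  let N : Matrix (Fin m) (Fin m) B := Matrix.of fun j j' => (d j : B) * φ (X (c j')) ^ (d j - 1)
  have hrow : ∀ j, ∑ j', N j j' • D (φ (X (c j'))) = 0 := by
    intro j
    have h0 := congrArg D (hφ j)
    simp only [diagonal, map_sub, map_sum, map_pow, map_zero] at h0
    rw [← algebraMap_eq, AlgHom.commutes, Derivation.map_algebraMap, sub_zero] at h0
    have h1 : ∑ j', D (φ (X (c j')) ^ d j) = ∑ i, D (φ (X i) ^ d j) := by
      rw [← Finset.sum_image (s := Finset.univ) (g := c) (f := fun i => D (φ (X i) ^ d j))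
        (fun _ _ _ _ h => hc h)]
      refine Finset.sum_subset (Finset.subset_univ _) fun i _ hi => ?_
      have hi' : i ∉ Set.range c := by simpa using hi
      rw [Derivation.leibniz_pow, hD i hi', smul_zero, smul_zero]
    rw [← h1] at h0
    rw [← h0]
    refine Finset.sum_congr rfl fun j' _ => ?_
    rw [Derivation.leibniz_pow, ← Nat.cast_smul_eq_nsmul B, smul_smul]
    rfl
  have hX : ∀ i, D (φ (X i)) = 0 := by
    intro i
    by_cases hi : i ∈ Set.range c
    · obtain ⟨j', rfl⟩ := hi
      have h1 : ∀ l, ∑ j', (N.adjugate * N) l j' • D (φ (X (c j'))) = 0 := by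
        intro l
        simp only [Matrix.mul_apply, Finset.sum_smul]
        rw [Finset.sum_comm]
        refine Finset.sum_eq_zero fun j _ => ?_
        simp only [mul_smul]
        rw [← Finset.smul_sum, hrow, smul_zero]
      have h2 := h1 j'
      rw [Matrix.adjugate_mul] at h2
      simp only [Matrix.smul_apply, Matrix.one_apply, smul_eq_mul, mul_ite, mul_one, mul_zero,
        ite_smul, zero_smul, Finset.sum_ite_eq, Finset.mem_univ, if_true] at h2
      exact hdet.smul_eq_zero.1 h2
    · exact hD i hi
  have hA : ∀ p, D (φ p) = 0 := by
    intro p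
    induction p using MvPolynomial.induction_on with
    | C a => rw [← algebraMap_eq, AlgHom.commutes, Derivation.map_algebraMap]
    | add p q hp hq => rw [map_add, map_add, hp, hq, add_zero]
    | mul_X p i hp => rw [map_mul, Derivation.leibniz, hp, hX, smul_zero, smul_zero, add_zero]
  ext x
  obtain ⟨p, s, hs, hx⟩ := hfrac x
  have := congrArg D hx
  rw [Derivation.leibniz, hA, hA, smul_zero, add_zero] at this
  exact hs.smul_eq_zero.1 this

/-- The point with values in the fraction field which is generic for `P`. -/
noncomputable def genericPoint (P : Ideal (MvPolynomial (Fin k) K)) [P.IsPrime] :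
    MvPolynomial (Fin k) K →ₐ[K] FractionRing (MvPolynomial (Fin k) K ⧸ P) :=
  (IsScalarTower.toAlgHom K (MvPolynomial (Fin k) K ⧸ P) _).comp (Ideal.Quotient.mkₐ K P)

theorem genericPoint_eq_zero {P : Ideal (MvPolynomial (Fin k) K)} [P.IsPrime]
    {p : MvPolynomial (Fin k) K} : genericPoint P p = 0 ↔ p ∈ P := by
  rw [← Ideal.Quotient.eq_zero_iff_mem]
  exact map_eq_zero_iff _ (IsFractionRing.injective (MvPolynomial (Fin k) K ⧸ P) _)

theorem exists_genericPoint_eq {P : Ideal (MvPolynomial (Fin k) K)} [P.IsPrime]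
    (x : FractionRing (MvPolynomial (Fin k) K ⧸ P)) :
    ∃ p s, IsUnit (genericPoint P s) ∧ genericPoint P s * x = genericPoint P p := by
  obtain ⟨a, s, hs, rfl⟩ := IsFractionRing.div_surjective (A := MvPolynomial (Fin k) K ⧸ P) x
  obtain ⟨p, rfl⟩ := Ideal.Quotient.mk_surjective a
  obtain ⟨s, rfl⟩ := Ideal.Quotient.mk_surjective s
  have hs' : algebraMap (MvPolynomial (Fin k) K ⧸ P) (FractionRing (MvPolynomial (Fin k) K ⧸ P))
      (Ideal.Quotient.mk P s) ≠ 0 :=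
    IsFractionRing.to_map_ne_zero_of_mem_nonZeroDivisors hs
  exact ⟨p, s, isUnit_iff_ne_zero.2 hs', mul_div_cancel₀ _ hs'⟩

/-- The Jacobian matrix of the `f_j` at the generic point of `P`. -/
noncomputable def genericJacobian (d : Fin m → ℕ) (P : Ideal (MvPolynomial (Fin k) K)) [P.IsPrime] :
    Matrix (Fin m) (Fin k) (FractionRing (MvPolynomial (Fin k) K ⧸ P)) :=
  Matrix.of fun j i => (d j : FractionRing (MvPolynomial (Fin k) K ⧸ P)) *
    genericPoint P (X i) ^ (d j - 1)

/-- The columns of the Jacobian matrix are values of the same functions at the different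
coordinates, so one row relation `∑ l_j d_j X_i ^ (d_j - 1) = 0` gives one univariate equation
satisfied by all coordinates. Dividing by `l j₀` leaves at most `m - 1` parameters. -/
theorem ringKrullDim_quotient_le_of_not_linearIndependent {P : Ideal (MvPolynomial (Fin k) K)}
    [P.IsPrime] (hd : ∀ j, 0 < d j) (hinj : Function.Injective d) (hdK : ∀ j, (d j : K) ≠ 0)
    (h : ¬ LinearIndependent (FractionRing (MvPolynomial (Fin k) K ⧸ P)) (genericJacobian d P).row) :
    0 < m ∧ ringKrullDim (MvPolynomial (Fin k) K ⧸ P) ≤ ((m - 1 : ℕ) : WithBot ℕ∞) := by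
  classical
  let F := FractionRing (MvPolynomial (Fin k) K ⧸ P)
  obtain ⟨l, hl, j₀, hj₀⟩ := Fintype.not_linearIndependent_iff.1 h
  have hm : 0 < m := j₀.pos
  refine ⟨hm, ?_⟩
  let μ : Fin m → F := fun j => l j / l j₀
  let T : Finset F := (Finset.univ.erase j₀).image μ
  let E := IntermediateField.adjoin K (T : Set F)
  have hμ : ∀ j, μ j ∈ E := by
    intro j
    by_cases hj : j = j₀
    · have : μ j = 1 := by rw [hj]; exact div_self hj₀
      rw [this]
      exact one_mem _
    · exact IntermediateField.subset_adjoin _ _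
        (Finset.mem_coe.2 (Finset.mem_image_of_mem μ (Finset.mem_erase.2 ⟨hj, Finset.mem_univ _⟩)))
  have hcard : T.card ≤ m - 1 := by
    refine Finset.card_image_le.trans ?_
    rw [Finset.card_erase_of_mem (Finset.mem_univ _)]
    simp
  refine (ringKrullDim_quotient_le (F := F) T fun i => ?_).trans (by exact_mod_cast hcard)
  -- This is nonzero: the exponents `d j - 1` are distinct and `μ j₀ = 1`, so one coefficient is `d
  -- j₀`, a unit in `K`.
  let q : Polynomial E := ∑ j, Polynomial.monomial (d j - 1) (⟨μ j, hμ j⟩ * (d j : E))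
  refine ⟨q, fun hq => ?_, ?_⟩
  · have h1 := congrArg (fun p => p.coeff (d j₀ - 1)) hq
    simp only [q, Polynomial.finsetSum_coeff, Polynomial.coeff_monomial, Polynomial.coeff_zero] at h1
    rw [Finset.sum_eq_single j₀] at h1
    · rw [if_pos rfl] at h1
      have h2 := congrArg (algebraMap E F) h1
      rw [map_mul, map_zero, map_natCast] at h2
      rcases mul_eq_zero.1 h2 with h3 | h3
      · have : μ j₀ = 1 := div_self hj₀
        exact one_ne_zero (this.symm.trans h3)
      · apply hdK j₀
        rw [← map_natCast (algebraMap K F)] at h3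
        exact (map_eq_zero _).1 h3
    · intro j _ hj
      rw [if_neg]
      intro h4
      have h5 := hd j
      have h6 := hd j₀
      exact hj (hinj (by omega))
    · simp
  · have h1 := congrFun hl i
    simp only [Finset.sum_apply, Pi.smul_apply, smul_eq_mul, Pi.zero_apply, Matrix.row,
      genericJacobian, Matrix.of_apply] at h1
    simp only [q, map_sum, Polynomial.aeval_monomial]
    have h2 : ∀ j, algebraMap E F (⟨μ j, hμ j⟩ * (d j : E)) *
        (genericPoint P (X i)) ^ (d j - 1) = (l j₀)⁻¹ * (l j * ((d j : F) *
          genericPoint P (X i) ^ (d j - 1))) := by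
      intro j
      rw [map_mul, map_natCast]
      change (l j / l j₀) * _ * _ = _
      rw [div_eq_mul_inv]
      ring
    change ∑ j, algebraMap E F (⟨μ j, hμ j⟩ * (d j : E)) * (genericPoint P (X i)) ^ (d j - 1) = 0
    simp only [h2]
    rw [← Finset.mul_sum, h1, mul_zero]

/-- The Jacobian criterion kills the universal derivation of `F` over `E`, the subfield generated by
the coordinates outside the minor. So `F / E` is unramified and essentially of finite type, hence
separable algebraic. -/
theorem isAlgebraic_genericPoint_X {P : Ideal (MvPolynomial (Fin k) K)}
    [P.IsPrime] (hP : ∀ j, diagonal k d b j ∈ P) {c : Fin m → Fin k} (hc : Function.Injective c)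
    (hdet : IsUnit ((genericJacobian d P).submatrix id c).det) (i : Fin k) :
    IsAlgebraic (IntermediateField.adjoin K
      ((fun i => genericPoint P (X i)) '' (Set.range c)ᶜ)) (genericPoint P (X i)) := by
  let F := FractionRing (MvPolynomial (Fin k) K ⧸ P)
  let E := IntermediateField.adjoin K ((fun i => genericPoint P (X i)) '' (Set.range c)ᶜ)
  have hD : (KaehlerDifferential.D E F).restrictScalars K = 0 := by
    refine derivation_eq_zero (genericPoint P) (fun j => genericPoint_eq_zero.2 (hP j))
      exists_genericPoint_eq hc hdet _ fun i hi => ?_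
    have hi' : genericPoint P (X i) ∈ E := IntermediateField.subset_adjoin _ _ ⟨i, hi, rfl⟩
    exact (KaehlerDifferential.D E F).map_algebraMap ⟨_, hi'⟩
  have hunr : Algebra.FormallyUnramified E F := formallyUnramified_of_forall_D_eq_zero fun x =>
    congrArg (fun D : Derivation K F (Ω[F⁄E]) => D x) hD
  have hess : Algebra.EssFiniteType K F :=
    Algebra.EssFiniteType.comp K (MvPolynomial (Fin k) K ⧸ P) F
  have hess' : Algebra.EssFiniteType E F := Algebra.EssFiniteType.of_comp K E F
  have hsep := Algebra.FormallyUnramified.isSeparable E F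
  exact Algebra.IsAlgebraic.isAlgebraic _

theorem ringKrullDim_quotient_le_of_linearIndependent {P : Ideal (MvPolynomial (Fin k) K)}
    [P.IsPrime] (hP : ∀ j, diagonal k d b j ∈ P)
    (h : LinearIndependent (FractionRing (MvPolynomial (Fin k) K ⧸ P)) (genericJacobian d P).row) :
    ringKrullDim (MvPolynomial (Fin k) K ⧸ P) ≤ ((k - m : ℕ) : WithBot ℕ∞) := by
  classical
  let F := FractionRing (MvPolynomial (Fin k) K ⧸ P)
  obtain ⟨c, hc, hdet⟩ := exists_isUnit_det_submatrix h
  let S : Finset (Fin k) := (Finset.univ.image c)ᶜ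
  let T : Finset F := S.image fun i => genericPoint P (X i)
  have hcard : T.card ≤ k - m := by
    refine Finset.card_image_le.trans ?_
    rw [Finset.card_compl, Finset.card_image_of_injective _ hc]
    simp
  refine (ringKrullDim_quotient_le (F := F) T fun i => ?_).trans (by exact_mod_cast hcard)
  have := isAlgebraic_genericPoint_X hP hc hdet i
  have hT : (T : Set F) = (fun i => genericPoint P (X i)) '' (Set.range c)ᶜ := by
    simp [T, S]
  rw [hT]
  exact this

/-- The zero locus of the `f_j` has dimension at most `k - m`. -/
theorem ringKrullDim_quotient_le_of_diagonal_mem {P : Ideal (MvPolynomial (Fin k) K)}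
    [P.IsPrime] (hd : ∀ j, 0 < d j) (hinj : Function.Injective d) (hdK : ∀ j, (d j : K) ≠ 0)
    (hmk : 2 * m ≤ k + 1) (hP : ∀ j, diagonal k d b j ∈ P) :
    ringKrullDim (MvPolynomial (Fin k) K ⧸ P) ≤ ((k - m : ℕ) : WithBot ℕ∞) := by
  by_cases h : LinearIndependent (FractionRing (MvPolynomial (Fin k) K ⧸ P)) (genericJacobian d P).row
  · exact ringKrullDim_quotient_le_of_linearIndependent hP h
  · obtain ⟨hm, h1⟩ := ringKrullDim_quotient_le_of_not_linearIndependent hd hinj hdK h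
    refine h1.trans ?_
    -- Here `2 * m ≤ k + 1` makes the degenerate bound no worse than the expected one.
    have : m - 1 ≤ k - m := by omega
    exact_mod_cast this

end Diagonal

end AffineVariety


namespace AffineVariety

open MvPolynomial

/-! ### Prime chains in quotients and associated primes -/

section Chains

variable {A : Type*} [CommRing A]

theorem length_le_height_map_quotient {P Q : Ideal A} [hP : P.IsPrime] [hQ : Q.IsPrime]
    (l : LTSeries (PrimeSpectrum A)) (hhead : l.head = ⟨P, hP⟩) (hlast : l.last.asIdeal ≤ Q) :
    (l.length : ℕ∞) ≤ (Q.map (Ideal.Quotient.mk P)).height := by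
  have hmem : ∀ i, l i ∈ PrimeSpectrum.zeroLocus (P : Set A) := fun i => by
    have := LTSeries.head_le l i
    rw [hhead] at this
    exact this
  have hPQ : P ≤ Q := by
    have h1 : l.head ≤ l.last := LTSeries.head_le_last l
    rw [hhead] at h1
    exact le_trans h1 hlast
  have hQ' : (Q.map (Ideal.Quotient.mk P)).IsPrime :=
    Ideal.map_isPrime_of_surjective Ideal.Quotient.mk_surjective (by rwa [Ideal.mk_ker])
  let e := Ideal.primeSpectrumQuotientOrderIsoZeroLocus P
  let l' : LTSeries (PrimeSpectrum.zeroLocus (P : Set A)) :=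
    { length := l.length
      toFun := fun i => ⟨l i, hmem i⟩
      step := fun i => l.step i }
  let l'' : LTSeries (PrimeSpectrum (A ⧸ P)) := l'.map e.symm e.symm.strictMono
  have hlast' : l''.last ≤ ⟨_, hQ'⟩ := by
    have h1 : l''.last = e.symm l'.last := rfl
    rw [h1, OrderIso.symm_apply_le]
    change l.last.asIdeal ≤ (Q.map (Ideal.Quotient.mk P)).comap (Ideal.Quotient.mk P)
    exact hlast.trans Ideal.le_comap_map
  have := Order.length_le_height hlast'
  rw [← PrimeSpectrum.height_eq_orderHeight] at this
  exact this

theorem length_le_ringKrullDim_quotient {P Q : Ideal A} [hP : P.IsPrime] [hQ : Q.IsPrime]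
    (l : LTSeries (PrimeSpectrum A)) (hhead : l.head = ⟨P, hP⟩) (hlast : l.last.asIdeal ≤ Q) :
    (l.length : WithBot ℕ∞) ≤ ringKrullDim (A ⧸ P) := by
  have hPQ : P ≤ Q := by
    have h1 : l.head ≤ l.last := LTSeries.head_le_last l
    rw [hhead] at h1
    exact le_trans h1 hlast
  have hQ' : (Q.map (Ideal.Quotient.mk P)).IsPrime :=
    Ideal.map_isPrime_of_surjective Ideal.Quotient.mk_surjective (by rwa [Ideal.mk_ker])
  refine le_trans ?_ (Ideal.height_le_ringKrullDim_of_isPrime (I := Q.map (Ideal.Quotient.mk P)))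
  exact_mod_cast length_le_height_map_quotient l hhead hlast

/-- Over a noetherian ring, a minimal prime over the annihilator `J : u` is itself an annihilator `J
: w`, that is, an associated prime of `A / J`. -/
theorem exists_prime_of_not_mem [IsNoetherianRing A] {J 𝔪 : Ideal A} [𝔪.IsPrime] {u : A}
    (hu : ∀ a, a * u ∈ J → a ∈ 𝔪) :
    ∃ P : Ideal A, P.IsPrime ∧ P ≤ 𝔪 ∧ (∀ a, a * u ∈ J → a ∈ P) ∧
      ∃ w, ∀ a, a ∈ P ↔ a * w ∈ J := by
  have hle : J.colon {u} ≤ 𝔪 := fun a ha =>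
    hu a (by simpa using Submodule.mem_colon_singleton.1 ha)
  obtain ⟨P, hP, hP𝔪⟩ := Ideal.exists_minimalPrimes_le hle
  obtain ⟨w, hw⟩ := Submodule.exists_eq_colon_of_mem_minimalPrimes hP
  refine ⟨P, hP.1.1, hP𝔪, fun a ha => hP.1.2 (Submodule.mem_colon_singleton.2 ha), w, fun a => ?_⟩
  rw [hw, Submodule.mem_colon_singleton, smul_eq_mul]

theorem exists_mem_iff_of_mem_minimalPrimes [IsNoetherianRing A] {J P : Ideal A}
    (hP : P ∈ J.minimalPrimes) : ∃ w, ∀ a, a ∈ P ↔ a * w ∈ J := by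
  have : P ∈ (J.colon {(1 : A)}).minimalPrimes := by
    convert hP
    ext a
    simp [Submodule.mem_colon_singleton]
  obtain ⟨w, hw⟩ := Submodule.exists_eq_colon_of_mem_minimalPrimes this
  exact ⟨w, fun a => by rw [hw, Submodule.mem_colon_singleton, smul_eq_mul]⟩

end Chains

/-! ### The diagonal polynomials form a regular sequence -/

section RegularSequence

variable {Ω : Type*} [Field Ω] {k m : ℕ} {d : Fin m → ℕ} {b : Fin m → Ω}

theorem exists_le_vanishingIdeal_singleton [IsAlgClosed Ω] {I : Ideal (MvPolynomial (Fin k) Ω)}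
    (hI : I ≠ ⊤) :
    ∃ x : Fin k → Ω, I ≤ vanishingIdeal Ω {x} := by
  obtain ⟨M, hM, hIM⟩ := I.exists_le_maximal hI
  obtain ⟨x, rfl⟩ := eq_vanishingIdeal_singleton_of_isMaximal Ω hM
  exact ⟨x, hIM⟩

/-- The ideal generated by the first `i` of the `f_j`. -/
noncomputable def initialIdeal (k : ℕ) (d : Fin m → ℕ) (b : Fin m → Ω) (i : ℕ) :
    Ideal (MvPolynomial (Fin k) Ω) :=
  Ideal.span (diagonal k d b '' {j | (j : ℕ) < i})

theorem initialIdeal_succ {i : ℕ} (hi : i < m) :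
    initialIdeal k d b (i + 1) = initialIdeal k d b i ⊔ Ideal.span {diagonal k d b ⟨i, hi⟩} := by
  rw [initialIdeal, initialIdeal, ← Ideal.span_union, ← Set.image_singleton, ← Set.image_union]
  congr 2
  ext j
  simp only [Set.mem_ofPred_eq, Set.mem_union, Set.mem_singleton_iff, Fin.ext_iff]
  omega

theorem initialIdeal_eq_span : initialIdeal k d b m = Ideal.span (Set.range (diagonal k d b)) := by
  rw [initialIdeal, ← Set.image_univ]
  congr 2
  ext j
  simp

theorem ringKrullDim_quotient_le_of_initialIdeal_le {P : Ideal (MvPolynomial (Fin k) Ω)}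
    [P.IsPrime] (hd : ∀ j, 0 < d j) (hinj : Function.Injective d) (hdK : ∀ j, (d j : Ω) ≠ 0)
    (hmk : 2 * m ≤ k + 1) {i : ℕ} (hi : i ≤ m) (hP : initialIdeal k d b i ≤ P) :
    ringKrullDim (MvPolynomial (Fin k) Ω ⧸ P) ≤ ((k - i : ℕ) : WithBot ℕ∞) := by
  refine ringKrullDim_quotient_le_of_diagonal_mem (m := i) (d := d ∘ Fin.castLE hi)
    (b := b ∘ Fin.castLE hi) (fun j => hd _) (hinj.comp (Fin.castLE_injective hi))
    (fun j => hdK _) (by omega) fun j => hP (Ideal.subset_span ⟨Fin.castLE hi j, ?_, rfl⟩)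
  exact j.2

variable [IsAlgClosed Ω]

/-- A zero divisor modulo the first `i` polynomials lies in an associated prime `P`. Depth `k - i`
at a point of `P` yields a chain of that length above `P`, while `P` contains `i + 1` of the
polynomials, so `A / P` has dimension at most `k - (i + 1)`. -/
theorem regularMod_diagonal (hd : ∀ j, 0 < d j) (hinj : Function.Injective d)
    (hdK : ∀ j, (d j : Ω) ≠ 0) (hmk : 2 * m ≤ k + 1) {i : ℕ} (hi : i < m)
    (hdepth : ∀ x : Fin k → Ω, initialIdeal k d b i ≤ vanishingIdeal Ω {x} →
      HasDepth (vanishingIdeal Ω {x}) (k - i) (initialIdeal k d b i)) :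
    RegularMod (initialIdeal k d b i) (diagonal k d b ⟨i, hi⟩) := by
  intro a ha
  by_contra ha'
  have hne : (initialIdeal k d b i).colon {a} ≠ ⊤ := by simpa using ha'
  obtain ⟨M, hM, hle⟩ := Ideal.exists_le_maximal _ hne
  obtain ⟨P, hP, -, haP, w, hw⟩ := exists_prime_of_not_mem (J := initialIdeal k d b i) (u := a)
    (𝔪 := M) fun c hc => hle (Submodule.mem_colon_singleton.2 hc)
  have hJP : initialIdeal k d b (i + 1) ≤ P := by
    rw [initialIdeal_succ hi, sup_le_iff, Ideal.span_singleton_le_iff_mem]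
    exact ⟨fun c hc => haP c (Ideal.mul_mem_right _ _ hc), haP _ ha⟩
  obtain ⟨x, hx⟩ := exists_le_vanishingIdeal_singleton hP.ne_top
  have hJi : initialIdeal k d b i ≤ initialIdeal k d b (i + 1) := by
    rw [initialIdeal_succ hi]
    exact le_sup_left
  obtain ⟨l, hl, hhead, hlast⟩ :=
    (hdepth x ((hJi.trans hJP).trans hx)).exists_ltSeries hP hw hx
  have h1 := length_le_ringKrullDim_quotient l hhead hlast
  have h2 := ringKrullDim_quotient_le_of_initialIdeal_le hd hinj hdK hmk hi hJP
  rw [hl] at h1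
  have h3 : k - i ≤ k - (i + 1) := by exact_mod_cast h1.trans h2
  omega

/-- Induction on `i`: depth at every point for one segment makes the next polynomial regular, and
dividing by that regular element lowers the depth by one. -/
theorem hasDepth_initialIdeal (hd : ∀ j, 0 < d j) (hinj : Function.Injective d)
    (hdK : ∀ j, (d j : Ω) ≠ 0) (hmk : 2 * m ≤ k + 1) {i : ℕ} (hi : i ≤ m) (x : Fin k → Ω)
    (hx : initialIdeal k d b i ≤ vanishingIdeal Ω {x}) :
    HasDepth (vanishingIdeal Ω {x}) (k - i) (initialIdeal k d b i) := by
  induction i generalizing x with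
  | zero => simpa [initialIdeal] using hasDepth_vanishingIdeal x
  | succ i ih =>
    have hJi : initialIdeal k d b (i + 1) =
        initialIdeal k d b i ⊔ Ideal.span {diagonal k d b ⟨i, hi⟩} := initialIdeal_succ hi
    have h1 := ih (by omega) x ((hJi ▸ le_sup_left).trans hx)
    have h2 : k - i = k - (i + 1) + 1 := by omega
    rw [h2] at h1
    rw [hJi]
    refine h1.sup_span_singleton ?_ (regularMod_diagonal hd hinj hdK hmk hi (ih (by omega)))
    rw [hJi, sup_le_iff, Ideal.span_singleton_le_iff_mem] at hx
    exact hx.2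

/-- A minimal prime over the first `i` polynomials consists of zero divisors, so it misses the next
polynomial and lies strictly below `P`. -/
theorem le_height_of_initialIdeal_le (hd : ∀ j, 0 < d j) (hinj : Function.Injective d)
    (hdK : ∀ j, (d j : Ω) ≠ 0) (hmk : 2 * m ≤ k + 1) {i : ℕ} (hi : i ≤ m)
    {P : Ideal (MvPolynomial (Fin k) Ω)} [P.IsPrime] (hP : initialIdeal k d b i ≤ P) :
    (i : ℕ∞) ≤ P.height := by
  induction i generalizing P with
  | zero => simp
  | succ i ih =>
    have hJi : initialIdeal k d b (i + 1) =
        initialIdeal k d b i ⊔ Ideal.span {diagonal k d b ⟨i, hi⟩} := initialIdeal_succ hi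
    rw [hJi, sup_le_iff, Ideal.span_singleton_le_iff_mem] at hP
    obtain ⟨P', hP', hP'P⟩ := Ideal.exists_minimalPrimes_le hP.1
    have hP'p : P'.IsPrime := hP'.1.1
    obtain ⟨w, hw⟩ := exists_mem_iff_of_mem_minimalPrimes hP'
    have hreg := regularMod_diagonal hd hinj hdK hmk hi
      (hasDepth_initialIdeal (b := b) hd hinj hdK hmk (by omega))
    have hlt : P' < P := by
      refine lt_of_le_of_ne hP'P fun heq => ?_
      have h1 := hP.2
      rw [← heq, hw] at h1
      apply hP'p.ne_top
      rw [Ideal.eq_top_iff_one, hw, one_mul]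
      exact hreg w h1
    have h2 := Ideal.height_add_one_le_of_lt_of_isPrime hlt
    have h3 := ih (by omega) hP'.1.2
    push_cast
    exact (add_le_add_left h3 1).trans h2

/-- The components of `V` have dimension at least `k - m` at all of their points. -/
theorem exists_ltSeries_of_mem_iff (hd : ∀ j, 0 < d j) (hinj : Function.Injective d)
    (hdK : ∀ j, (d j : Ω) ≠ 0) (hmk : 2 * m ≤ k + 1)
    {P : Ideal (MvPolynomial (Fin k) Ω)} (hP : P.IsPrime) {w : MvPolynomial (Fin k) Ω}
    (hw : ∀ a, a ∈ P ↔ a * w ∈ Ideal.span (Set.range (diagonal k d b)))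
    {x : Fin k → Ω} (hx : P ≤ vanishingIdeal Ω {x}) :
    ∃ l : LTSeries (PrimeSpectrum (MvPolynomial (Fin k) Ω)), l.length = k - m ∧
      l.head = ⟨P, hP⟩ ∧ l.last.asIdeal ≤ vanishingIdeal Ω {x} := by
  rw [← initialIdeal_eq_span] at hw
  have hJP : initialIdeal k d b m ≤ P := fun a ha => (hw a).2 (Ideal.mul_mem_right _ _ ha)
  exact (hasDepth_initialIdeal hd hinj hdK hmk le_rfl x (hJP.trans hx)).exists_ltSeries hP hw hx

end RegularSequence

end AffineVariety


namespace AffineVariety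

open MvPolynomial

/-! ### Reducedness at the associated primes -/

section Radical

variable {Ω : Type*} [Field Ω] {k m : ℕ} {d : Fin m → ℕ} {b : Fin m → Ω}

/-- An algebra which is generated by the coordinates and by inverses of elements outside of `P`, and
in which the `f_j` vanish, is reduced if the Jacobian matrix has full rank at `P`. -/
theorem isReduced_of_linearIndependent {P : Ideal (MvPolynomial (Fin k) Ω)} [hP : P.IsPrime]
    (hJP : ∀ j, diagonal k d b j ∈ P)
    (hdim : ((k - m : ℕ) : WithBot ℕ∞) ≤ ringKrullDim (MvPolynomial (Fin k) Ω ⧸ P))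
    (hli : LinearIndependent (FractionRing (MvPolynomial (Fin k) Ω ⧸ P))
      (genericJacobian d P).row) {T : Type*} [CommRing T] [Algebra Ω T] [Algebra.EssFiniteType Ω T]
    (φ : MvPolynomial (Fin k) Ω →ₐ[Ω] T) (hφ : ∀ j, φ (diagonal k d b j) = 0)
    (hunit : ∀ s ∉ P, IsUnit (φ s)) (hfrac : ∀ x : T, ∃ p, ∃ s ∉ P, φ s * x = φ p) :
    IsReduced T := by
  classical
  let A := MvPolynomial (Fin k) Ω
  obtain ⟨c, hc, hdet⟩ := exists_isUnit_det_submatrix hli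
  let S := {i : Fin k // i ∉ Set.range c}
  let y : S → FractionRing (A ⧸ P) := fun i => genericPoint P (X i.1)
  -- The `k - m` coordinates outside the minor generate the function field up to algebraic
  -- extension, and its transcendence degree is at least `k - m`, so they are a transcendence basis.
  have hy : AlgebraicIndependent Ω y := by
    refine algebraicIndependent_of_card_le_ringKrullDim (P := P) y (fun i => ?_) ?_
    · have h1 := isAlgebraic_genericPoint_X hJP hc hdet i
      have h2 : Set.range y = (fun i => genericPoint P (X i)) '' (Set.range c)ᶜ := by
        ext z
        simp [y, S]
      rw [h2]
      exact h1
    · convert hdim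
      rw [Fintype.card_subtype_compl, Fintype.card_fin]
      congr 1
      have : Fintype.card {i // i ∈ Set.range c} = Fintype.card (Fin m) :=
        (Fintype.card_congr (Equiv.ofInjective c hc)).symm
      simpa using this
  have hdetT : IsUnit (Matrix.of fun j j' : Fin m =>
      (d j : T) * φ (X (c j')) ^ (d j - 1)).det := by
    let N : Matrix (Fin m) (Fin m) A := Matrix.of fun j j' => (d j : A) * X (c j') ^ (d j - 1)
    have h1 : (Matrix.of fun j j' : Fin m => (d j : T) * φ (X (c j')) ^ (d j - 1)) =
        φ.toRingHom.mapMatrix N := by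
      ext j j'
      simp [N]
    have h2 : (genericJacobian d P).submatrix id c = (genericPoint P).toRingHom.mapMatrix N := by
      ext j j'
      simp [N, genericJacobian]
    rw [h1, ← RingHom.map_det]
    refine hunit _ fun h3 => ?_
    rw [h2, ← RingHom.map_det] at hdet
    exact hdet.ne_zero (genericPoint_eq_zero.2 h3)
  -- By independence, no nonzero polynomial in these coordinates lies in `P`, so all become units in
  -- `T`. This makes `T` an algebra over the rational function field `L`, unramified by the Jacobian
  -- criterion and therefore reduced.
  let L := FractionRing (MvPolynomial S Ω)
  let θ : MvPolynomial S Ω →ₐ[Ω] T := φ.comp (rename Subtype.val)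
  have hθ : ∀ p : nonZeroDivisors (MvPolynomial S Ω), IsUnit (θ p) := by
    intro p
    refine hunit _ fun h1 => ?_
    have h3 : genericPoint P (rename Subtype.val p.1) = aeval y p.1 := by
      have : (genericPoint P).comp (rename Subtype.val) = aeval (R := Ω) y := by
        ext i
        simp [y]
      exact congrArg (fun f => f p.1) this
    exact nonZeroDivisors.ne_zero p.2
      (hy.eq_zero_of_aeval_eq_zero _ (h3.symm.trans (genericPoint_eq_zero.2 h1)))
  let ψ : L →+* T := IsLocalization.lift (M := nonZeroDivisors (MvPolynomial S Ω)) (S := L)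
    (g := (θ : MvPolynomial S Ω →+* T)) hθ
  have hψ : ∀ p : MvPolynomial S Ω, ψ (algebraMap _ L p) = θ p := fun p =>
    IsLocalization.lift_eq (M := nonZeroDivisors (MvPolynomial S Ω)) (S := L)
      (g := (θ : MvPolynomial S Ω →+* T)) hθ p
  let algLT : Algebra L T := ψ.toAlgebra
  have hψL : ∀ p : MvPolynomial S Ω, algebraMap L T (algebraMap _ L p) = θ p := hψ
  have htower : IsScalarTower Ω L T := IsScalarTower.of_algebraMap_eq fun a => by
    rw [IsScalarTower.algebraMap_apply Ω (MvPolynomial S Ω) L, hψL]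
    exact (AlgHom.commutes θ a).symm
  have hD : (KaehlerDifferential.D L T).restrictScalars Ω = 0 := by
    refine derivation_eq_zero φ hφ (fun x => ?_) hc hdetT _ fun i hi => ?_
    · obtain ⟨p, s, hs, h⟩ := hfrac x
      exact ⟨p, s, hunit s hs, h⟩
    · have h1 : φ (X i) = algebraMap L T (algebraMap (MvPolynomial S Ω) L (X ⟨i, hi⟩)) := by
        rw [hψL]
        simp [θ]
      rw [h1]
      exact (KaehlerDifferential.D L T).map_algebraMap _
  have hunr : Algebra.FormallyUnramified L T := formallyUnramified_of_forall_D_eq_zero fun x =>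
    congrArg (fun D : Derivation Ω T (Ω[T⁄L]) => D x) hD
  have hess3 : Algebra.EssFiniteType L T := Algebra.EssFiniteType.of_comp Ω L T
  exact Algebra.FormallyUnramified.isReduced_of_field L T

/-- `V` is reduced at the prime `P` if the Jacobian matrix has full rank there. -/
theorem exists_mul_mem_of_pow_mem {P : Ideal (MvPolynomial (Fin k) Ω)} [hP : P.IsPrime]
    (hJP : ∀ j, diagonal k d b j ∈ P)
    (hdim : ((k - m : ℕ) : WithBot ℕ∞) ≤ ringKrullDim (MvPolynomial (Fin k) Ω ⧸ P))
    (hli : LinearIndependent (FractionRing (MvPolynomial (Fin k) Ω ⧸ P))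
      (genericJacobian d P).row) {g : MvPolynomial (Fin k) Ω} {r : ℕ}
    (hg : g ^ r ∈ Ideal.span (Set.range (diagonal k d b))) :
    ∃ s ∉ P, s * g ∈ Ideal.span (Set.range (diagonal k d b)) := by
  let A := MvPolynomial (Fin k) Ω
  let J : Ideal A := Ideal.span (Set.range (diagonal k d b))
  let B := Localization.AtPrime P
  let T := B ⧸ J.map (algebraMap A B)
  let φ : A →ₐ[Ω] T := IsScalarTower.toAlgHom Ω A T
  have hφmk : ∀ a, φ a = Ideal.Quotient.mk (J.map (algebraMap A B)) (algebraMap A B a) :=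
    fun _ => rfl
  have hφ : ∀ a ∈ J, φ a = 0 := fun a ha => by
    rw [hφmk, Ideal.Quotient.eq_zero_iff_mem]
    exact Ideal.mem_map_of_mem _ ha
  have hess1 : Algebra.EssFiniteType Ω B := Algebra.EssFiniteType.comp Ω A B
  have hess2 : Algebra.EssFiniteType Ω T := Algebra.EssFiniteType.comp Ω B T
  have hred : IsReduced T := by
    refine isReduced_of_linearIndependent (T := T) hJP hdim hli φ
      (fun j => hφ _ (Ideal.subset_span ⟨j, rfl⟩)) (fun s hs => ?_) fun x => ?_
    · rw [hφmk]
      exact (IsLocalization.map_units B (⟨s, hs⟩ : P.primeCompl)).map _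
    · obtain ⟨z, rfl⟩ := Ideal.Quotient.mk_surjective x
      obtain ⟨a, s, rfl⟩ := IsLocalization.exists_mk'_eq P.primeCompl z
      refine ⟨a, s, s.2, ?_⟩
      rw [hφmk, hφmk, ← map_mul, mul_comm, IsLocalization.mk'_spec]
  have hg0 : φ g = 0 := by
    have h1 := hφ _ hg
    rw [map_pow] at h1
    exact IsReduced.eq_zero _ ⟨r, h1⟩
  rw [hφmk, Ideal.Quotient.eq_zero_iff_mem,
    IsLocalization.mem_map_algebraMap_iff P.primeCompl] at hg0
  obtain ⟨⟨⟨j, hj⟩, s⟩, hs⟩ := hg0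
  rw [← map_mul] at hs
  obtain ⟨t, ht⟩ := (IsLocalization.eq_iff_exists P.primeCompl B).1 hs
  refine ⟨t * s, P.primeCompl.mul_mem t.2 s.2, ?_⟩
  have : (t : A) * s * g = t * j := by
    rw [← ht]
    ring
  change (t : A) * s * g ∈ J
  rw [this]
  exact J.mul_mem_left _ hj

/-- If `g` is nilpotent but nonzero modulo `J`, take an associated prime `P` containing its
annihilator. Its quotient has dimension at least `k - m > m - 1`, so the Jacobian has full rank
there and some `s ∉ P` annihilates `g`, a contradiction. -/
theorem isRadical_span_diagonal [IsAlgClosed Ω] (hd : ∀ j, 0 < d j) (hinj : Function.Injective d)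
    (hdK : ∀ j, (d j : Ω) ≠ 0) (hmk : 2 * m ≤ k) :
    (Ideal.span (Set.range (diagonal k d b))).IsRadical := by
  rintro g ⟨r, hg⟩
  by_contra hgJ
  have hne : (Ideal.span (Set.range (diagonal k d b))).colon {g} ≠ ⊤ := by simpa using hgJ
  obtain ⟨M, hM, hle⟩ := Ideal.exists_le_maximal _ hne
  obtain ⟨P, hP, -, hgP, w, hw⟩ := exists_prime_of_not_mem
    (J := Ideal.span (Set.range (diagonal k d b))) (u := g)
    (𝔪 := M) fun c hc => hle (Submodule.mem_colon_singleton.2 hc)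
  obtain ⟨x, hx⟩ := exists_le_vanishingIdeal_singleton hP.ne_top
  obtain ⟨l, hl, hhead, hlast⟩ := exists_ltSeries_of_mem_iff hd hinj hdK (by omega) hP hw hx
  have hdim := length_le_ringKrullDim_quotient l hhead hlast
  rw [hl] at hdim
  have hli : LinearIndependent (FractionRing (MvPolynomial (Fin k) Ω ⧸ P))
      (genericJacobian d P).row := by
    by_contra hli
    obtain ⟨hm, h1⟩ := ringKrullDim_quotient_le_of_not_linearIndependent hd hinj hdK hli
    have h2 : k - m ≤ m - 1 := by exact_mod_cast hdim.trans h1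
    omega
  obtain ⟨s, hsP, hs⟩ := exists_mul_mem_of_pow_mem
    (fun j => (hw _).2 (Ideal.mul_mem_right _ _ (Ideal.subset_span ⟨j, rfl⟩))) hdim hli hg
  exact hsP (hgP s hs)

end Radical

end AffineVariety


namespace AffineVariety

open MvPolynomial

theorem ringKrullDim_quotient_le_of_forall {A : Type*} [CommRing A] {I : Ideal A}
    {n : WithBot ℕ∞} (h : ∀ P : Ideal A, P.IsPrime → I ≤ P → ringKrullDim (A ⧸ P) ≤ n) :
    ringKrullDim (A ⧸ I) ≤ n := by
  rw [ringKrullDim_quotient]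
  refine iSup_le fun l => ?_
  let l' : LTSeries (PrimeSpectrum A) := l.map Subtype.val (Subtype.strictMono_coe _)
  have hp := l'.head.2
  have := l'.last.2
  exact (length_le_ringKrullDim_quotient (P := l'.head.asIdeal) (Q := l'.last.asIdeal) l' rfl
    le_rfl).trans (h _ hp l.head.2)

/-! ### Nonemptiness through homogenization -/

section Nonempty

variable {Ω : Type*} [Field Ω] {k m : ℕ}

theorem le_height_vanishingIdeal_singleton (x : Fin k → Ω) :
    (k : ℕ∞) ≤ (vanishingIdeal Ω {x}).height := by
  obtain ⟨l, hl, -, hlast⟩ := (hasDepth_vanishingIdeal x).exists_ltSeries (P := ⊥)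
    Ideal.isPrime_bot (u := 1) (fun a => by simp) bot_le
  have h : l.last ≤ ⟨vanishingIdeal Ω {x}, inferInstance⟩ := hlast
  have := Order.length_le_height h
  rwa [← PrimeSpectrum.height_eq_orderHeight, hl] at this

/-- The homogenization of `f_j`. -/
noncomputable def homogeneousDiagonal (k : ℕ) (d : Fin m → ℕ) (b : Fin m → Ω) (j : Fin m) :
    MvPolynomial (Fin (k + 1)) Ω :=
  (∑ i : Fin k, X i.succ ^ d j) - C (b j) * X 0 ^ d j

/-- On the hyperplane `X 0 = 0` the homogenized system is the diagonal system with all constants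
zero, to which the dimension bound already applies. -/
theorem ringKrullDim_quotient_le_of_homogeneousDiagonal_mem {d : Fin m → ℕ} {b : Fin m → Ω}
    (hd : ∀ j, 0 < d j) (hinj : Function.Injective d) (hdK : ∀ j, (d j : Ω) ≠ 0)
    (hmk : 2 * m ≤ k + 1) {P : Ideal (MvPolynomial (Fin (k + 1)) Ω)} [hP : P.IsPrime]
    (hX : X 0 ∈ P) (hF : ∀ j, homogeneousDiagonal k d b j ∈ P) :
    ringKrullDim (MvPolynomial (Fin (k + 1)) Ω ⧸ P) ≤ ((k - m : ℕ) : WithBot ℕ∞) := by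
  let ψ : MvPolynomial (Fin k) Ω →ₐ[Ω] MvPolynomial (Fin (k + 1)) Ω ⧸ P :=
    aeval fun i => Ideal.Quotient.mk P (X i.succ)
  have hX0 : Ideal.Quotient.mk P (X 0) = 0 := Ideal.Quotient.eq_zero_iff_mem.2 hX
  have hψ : ∀ r, ψ (aeval (Fin.cons 0 X) r) = Ideal.Quotient.mk P r := by
    intro r
    have : ψ.comp (aeval (R := Ω) (Fin.cons 0 X)) = Ideal.Quotient.mkₐ Ω P := by
      ext i
      refine Fin.cases ?_ (fun i => ?_) i
      · simp [hX0]
      · simp [ψ]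
    exact congrArg (fun f => f r) this
  have hsurj : Function.Surjective ψ := fun z => by
    obtain ⟨r, rfl⟩ := Ideal.Quotient.mk_surjective z
    exact ⟨_, hψ r⟩
  have hker : (RingHom.ker ψ).IsPrime := RingHom.ker_isPrime _
  have hdim := ringKrullDim_quotient_le_of_diagonal_mem (P := RingHom.ker ψ) (b := fun _ => 0)
    hd hinj hdK hmk (fun j => by
      rw [RingHom.mem_ker]
      have h1 : ψ (diagonal k d (fun _ => 0) j) = Ideal.Quotient.mk P
          (homogeneousDiagonal k d b j) + Ideal.Quotient.mk P (C (b j) * X 0 ^ d j) := by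
        simp [diagonal, homogeneousDiagonal, ψ]
      rw [h1, Ideal.Quotient.eq_zero_iff_mem.2 (hF j), map_mul, map_pow, hX0,
        zero_pow (hd j).ne', mul_zero, add_zero])
  rwa [ringKrullDim_eq_of_ringEquiv
    (Ideal.quotientKerAlgEquivOfSurjective hsurj).toRingEquiv] at hdim

/-- The variety `V` is not empty. -/
theorem span_diagonal_ne_top [IsAlgClosed Ω] {d : Fin m → ℕ} {b : Fin m → Ω}
    (hd : ∀ j, 0 < d j) (hinj : Function.Injective d) (hdK : ∀ j, (d j : Ω) ≠ 0)
    (hmk : 2 * m ≤ k + 1) (hmk' : m ≤ k) : Ideal.span (Set.range (diagonal k d b)) ≠ ⊤ := by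
  intro htop
  let I := Ideal.span (Set.range (homogeneousDiagonal k d b))
  -- A zero of the homogenized system with nonzero `X 0` could be dehomogenized to a point of `V`,
  -- which is assumed empty; the Nullstellensatz does the rest.
  have hX : X 0 ∈ I.radical := by
    rw [← vanishingIdeal_zeroLocus_eq_radical (K := Ω)]
    intro x hx
    rw [zeroLocus_span] at hx
    by_contra hx0
    rw [aeval_X] at hx0
    have h1 : Ideal.span (Set.range (diagonal k d b)) ≤
        vanishingIdeal Ω {fun i : Fin k => x i.succ / x 0} := by
      rw [Ideal.span_le]
      rintro _ ⟨j, rfl⟩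
      have h2 := hx _ ⟨j, rfl⟩
      simp only [homogeneousDiagonal, map_sub, map_sum, map_pow, map_mul, aeval_X, aeval_C,
        Algebra.algebraMap_self, RingHom.id_apply] at h2
      simp only [SetLike.mem_coe, mem_vanishingIdeal_singleton_iff, diagonal, map_sub, map_sum,
        map_pow, aeval_X, aeval_C, Algebra.algebraMap_self, RingHom.id_apply, div_pow]
      rw [← Finset.sum_div, sub_eq_zero.1 h2, mul_div_cancel_right₀ _ (pow_ne_zero _ hx0), sub_self]
    rw [htop, top_le_iff] at h1
    exact Ideal.IsPrime.ne_top inferInstance h1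
  have h1 : ringKrullDim (MvPolynomial (Fin (k + 1)) Ω ⧸ I) ≤ ((k - m : ℕ) : WithBot ℕ∞) :=
    ringKrullDim_quotient_le_of_forall fun P hP hIP =>
      ringKrullDim_quotient_le_of_homogeneousDiagonal_mem hd hinj hdK hmk
        (hP.radical_le_iff.2 hIP hX) fun j => hIP (Ideal.subset_span ⟨j, rfl⟩)
  have h2 : Set.range (homogeneousDiagonal k d b) ⊆
      (vanishingIdeal Ω {(0 : Fin (k + 1) → Ω)} : Ideal (MvPolynomial (Fin (k + 1)) Ω)) := by
    rintro _ ⟨j, rfl⟩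
    simp [homogeneousDiagonal, (hd j).ne']
  -- The ideal of the origin has height at least `k + 1` but contains these `m` polynomials, so `k +
  -- 1` would be at most `(k - m) + m`.
  have h3 := Ideal.height_le_ringKrullDim_quotient_add_encard
    (p := (vanishingIdeal Ω {(0 : Fin (k + 1) → Ω)})) _ h2
  have h4 : (Set.range (homogeneousDiagonal k d b)).encard ≤ m := by
    rw [← Set.image_univ]
    refine (Set.encard_image_le _ _).trans ?_
    simp
  have h5 : ((k + 1 : ℕ) : WithBot ℕ∞) ≤ ((k - m + m : ℕ) : WithBot ℕ∞) := by
    rw [Nat.cast_add (k - m) m]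
    refine le_trans ?_ (h3.trans (add_le_add h1 (by exact_mod_cast h4)))
    exact_mod_cast le_height_vanishingIdeal_singleton (0 : Fin (k + 1) → Ω)
  have h6 : k + 1 ≤ k - m + m := Nat.cast_le.1 h5
  omega

end Nonempty

end AffineVariety


namespace AffineVariety

open MvPolynomial

/-! ### Independence of multiplied monomials at isolated points -/

section BezoutBound

variable {Ω : Type*} [Field Ω] {k m n : ℕ} {ι : Type*}

/-- Points `x i` which are isolated in `V(Q i) ∩ V(ℓ i)`, where the `Q i` are minimal primes over
`(f_1, …, f_m)`, the expected dimensions hold, and `ℓ i` is determined by `Q i`. -/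
structure IsolatedPoints (f : Fin m → MvPolynomial (Fin k) Ω)
    (Q : ι → Ideal (MvPolynomial (Fin k) Ω)) (ℓ : ι → Fin n → MvPolynomial (Fin k) Ω)
    (x : ι → Fin k → Ω) : Prop where
  mem_minimalPrimes : ∀ i, Q i ∈ (Ideal.span (Set.range f)).minimalPrimes
  le_height : ∀ i, (m : ℕ∞) ≤ (Q i).height
  eq_of_eq : ∀ i j, Q i = Q j → ℓ i = ℓ j
  inj : ∀ i j, Q i = Q j → x i = x j → i = j
  le_vanishingIdeal : ∀ i, Q i ≤ vanishingIdeal Ω {x i}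
  map_mem_minimalPrimes : ∀ i, (vanishingIdeal Ω {x i}).map (Ideal.Quotient.mk (Q i)) ∈
    (Ideal.span (Set.range fun s => Ideal.Quotient.mk (Q i) (ℓ i s))).minimalPrimes
  le_height_map : ∀ i,
    (n : ℕ∞) ≤ ((vanishingIdeal Ω {x i}).map (Ideal.Quotient.mk (Q i))).height

variable {f : Fin m → MvPolynomial (Fin k) Ω}
    {Q : ι → Ideal (MvPolynomial (Fin k) Ω)} {ℓ : ι → Fin n → MvPolynomial (Fin k) Ω}
    {x : ι → Fin k → Ω}

/-- Distinct minimal primes are incomparable, so products of separating elements work. `H` is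
indexed by ideals rather than by `ι`, so that indices sharing a prime share a multiplier, which can
then be cancelled. -/
theorem exists_separating_minimalPrimes [Finite ι] {A : Type*} [CommRing A] {J : Ideal A}
    {Q : ι → Ideal A} (hQ : ∀ i, Q i ∈ J.minimalPrimes) :
    ∃ H : Ideal A → A, (∀ i, H (Q i) ∉ Q i) ∧ ∀ i j, Q i ≠ Q j → H (Q j) ∈ Q i := by
  classical
  have := Fintype.ofFinite ι
  have h : ∀ q q' : Ideal A, ∃ e : A, q ∈ J.minimalPrimes → q' ∈ J.minimalPrimes → q' ≠ q →
      e ∈ q' ∧ e ∉ q := by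
    intro q q'
    by_cases h : q' ≤ q
    · exact ⟨0, fun hq hq' hne => absurd (le_antisymm h (hq.2 hq'.1 h)) hne⟩
    · obtain ⟨e, he⟩ := SetLike.not_le_iff_exists.1 h
      exact ⟨e, fun _ _ _ => he⟩
  choose e he using h
  refine ⟨fun q => ∏ q' ∈ (Finset.univ.image Q).erase q, e q q', fun i hi => ?_, fun i j hij => ?_⟩
  · have := (hQ i).1.1
    obtain ⟨q', hq', hm⟩ := (Ideal.IsPrime.prod_mem_iff).1 hi
    obtain ⟨hne, hq'⟩ := Finset.mem_erase.1 hq'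
    obtain ⟨j, -, rfl⟩ := Finset.mem_image.1 hq'
    exact (he _ _ (hQ i) (hQ j) hne).2 hm
  · refine Ideal.mem_of_dvd _ (Finset.dvd_prod_of_mem _ (Finset.mem_erase.2
      ⟨hij, Finset.mem_image_of_mem _ (Finset.mem_univ i)⟩)) ?_
    exact (he _ _ (hQ j) (hQ i) hij).1

theorem exists_separating_points [Finite ι] (x : ι → Fin k → Ω) :
    ∃ g : ι → MvPolynomial (Fin k) Ω, (∀ i, aeval (x i) (g i) ≠ 0) ∧
      ∀ i j, x i ≠ x j → aeval (x i) (g j) = 0 := by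
  classical
  have := Fintype.ofFinite ι
  have h : ∀ y z : Fin k → Ω, ∃ e : MvPolynomial (Fin k) Ω, z ≠ y →
      aeval z e = 0 ∧ aeval y e ≠ 0 := by
    intro y z
    by_cases h : z = y
    · exact ⟨0, fun hne => absurd h hne⟩
    · obtain ⟨t, ht⟩ := Function.ne_iff.1 h
      refine ⟨X t - C (z t), fun _ => ⟨by simp, ?_⟩⟩
      simpa [sub_eq_zero] using Ne.symm ht
  choose e he using h
  refine ⟨fun i => ∏ z ∈ (Finset.univ.image x).erase (x i), e (x i) z, fun i => ?_,
    fun i j hij => ?_⟩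
  · rw [map_prod]
    exact Finset.prod_ne_zero_iff.2 fun z hz => (he _ _ (Finset.mem_erase.1 hz).1).2
  · rw [map_prod]
    exact Finset.prod_eq_zero (Finset.mem_erase.2
      ⟨hij, Finset.mem_image_of_mem _ (Finset.mem_univ i)⟩) (he _ _ hij).1

/-- Modulo `Q i` only the terms with `Q j = Q i` survive; they share `ℓ` and the factor `H (Q i)`,
which cancels. What remains is a relation among parameters at all the points on `Q i`. A coefficient
vanishing at all these points is zero, since each `g j` isolates its own scalar, so analytic
independence applies. -/
theorem IsolatedPoints.eq_zero_of_sum_mem [Infinite Ω] [Fintype ι] (hc : IsolatedPoints f Q ℓ x)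
    {H : Ideal (MvPolynomial (Fin k) Ω) → MvPolynomial (Fin k) Ω}
    (hH : ∀ i, H (Q i) ∉ Q i) (hH' : ∀ i j, Q i ≠ Q j → H (Q j) ∈ Q i)
    {g : ι → MvPolynomial (Fin k) Ω} (hg : ∀ i, aeval (x i) (g i) ≠ 0)
    (hg' : ∀ i j, x i ≠ x j → aeval (x i) (g j) = 0) {L : ι → MvPolynomial (Fin n) Ω}
    (hL : ∀ i, ∑ j, H (Q j) * g j * aeval (ℓ j) (L j) ∈ Q i) : L = 0 := by
  classical
  funext i
  have hprime : (Q i).IsPrime := (hc.mem_minimalPrimes i).1.1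
  let φ := Ideal.Quotient.mk (Q i)
  let S : Finset ι := Finset.univ.filter fun j => Q j = Q i
  let p : MvPolynomial (Fin n) (MvPolynomial (Fin k) Ω ⧸ Q i) :=
    ∑ j ∈ S, C (φ (g j)) * map (algebraMap Ω _) (L j)
  have hcoeff : ∀ b, coeff b p = φ (∑ j ∈ S, g j * C (coeff b (L j))) := by
    intro b
    simp only [p, coeff_sum, coeff_C_mul, coeff_map, map_sum, map_mul]
    rfl
  have hmem : ∀ b, (∀ j : {j // Q j = Q i},
      coeff b p ∈ (vanishingIdeal Ω {x j}).map (Ideal.Quotient.mk (Q i))) →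
      ∀ j ∈ S, coeff b (L j) = 0 := by
    intro b hb j hj
    have hj' : Q j = Q i := by simpa [S] using hj
    have h1 := hb ⟨j, hj'⟩
    rw [hcoeff, Ideal.mem_quotient_iff_mem (hj'.symm.le.trans (hc.le_vanishingIdeal j)),
      mem_vanishingIdeal_singleton_iff, map_sum, Finset.sum_eq_single_of_mem j hj] at h1
    · rw [map_mul, aeval_C] at h1
      exact (mul_eq_zero.1 h1).resolve_left (hg j)
    · intro j' hj'' hne
      have h2 : Q j' = Q i := by simpa [S] using hj''
      rw [map_mul, hg' j j' fun h3 => hne (hc.inj _ _ (h2.trans hj'.symm) h3.symm), zero_mul]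
  have heval : eval (fun s => φ (ℓ i s)) p = 0 := by
    have h1 : eval (fun s => φ (ℓ i s)) p = φ (∑ j ∈ S, g j * aeval (ℓ j) (L j)) := by
      simp only [p, map_sum, map_mul, eval_C, eval_map]
      refine Finset.sum_congr rfl fun j hj => ?_
      rw [← hc.eq_of_eq j i (by simpa [S] using hj), aeval_def, hom_eval₂]
      rfl
    have h2 : φ (H (Q i)) * φ (∑ j ∈ S, g j * aeval (ℓ j) (L j)) = 0 := by
      rw [← map_mul, Finset.mul_sum, ← Ideal.Quotient.eq_zero_iff_mem.2 (hL i), map_sum, map_sum,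
        Finset.sum_filter]
      refine Finset.sum_congr rfl fun j _ => ?_
      split_ifs with h
      · rw [h, mul_assoc]
      · rw [eq_comm]
        refine Ideal.Quotient.eq_zero_iff_mem.2 ?_
        exact Ideal.mul_mem_right _ _ (Ideal.mul_mem_right _ _ (hH' i j (Ne.symm h)))
    rw [h1]
    exact (mul_eq_zero.1 h2).resolve_left fun h => hH i (Ideal.Quotient.eq_zero_iff_mem.1 h)
  have hp : p = 0 := by
    refine eq_zero_of_eval_eq_zero Ω (h := fun s => φ (ℓ i s))
      (Q := fun j : {j // Q j = Q i} => (vanishingIdeal Ω {x j}).map (Ideal.Quotient.mk (Q i)))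
      ?_ ?_ heval ?_
    · rintro ⟨j, hj⟩
      have := hc.map_mem_minimalPrimes j
      rw [hc.eq_of_eq j i hj] at this
      simp only
      convert this using 4; rw [hj]
    · rintro ⟨j, hj⟩
      have := hc.le_height_map j
      simp only
      rwa [hj] at this
    · intro b hb
      rw [hcoeff, Finset.sum_eq_zero, map_zero]
      intro j hj
      rw [hmem b hb j hj, C_0, mul_zero]
  ext b
  refine hmem b (fun j => ?_) i (by simp [S])
  rw [hp, coeff_zero]
  exact Ideal.zero_mem _

/-- Analytic independence is used a second time, for `f` at the minimal primes `Q i`. The relation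
is expanded in powers of `f`; a coefficient lying in every `Q i` vanishes by
`IsolatedPoints.eq_zero_of_sum_mem`. -/
theorem IsolatedPoints.exists_eq_zero_of_sum_mul_aeval_eq_zero [Infinite Ω] [Fintype ι]
    (hc : IsolatedPoints f Q ℓ x) : ∃ u : ι → MvPolynomial (Fin k) Ω,
    ∀ q : ι → MvPolynomial (Fin m ⊕ Fin n) Ω,
      ∑ j, u j * aeval (Sum.elim f (ℓ j)) (q j) = 0 → q = 0 := by
  obtain ⟨H, hH, hH'⟩ := exists_separating_minimalPrimes hc.mem_minimalPrimes
  obtain ⟨g, hg, hg'⟩ := exists_separating_points x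
  refine ⟨fun j => H (Q j) * g j, fun q hq => ?_⟩
  let L : ι → MvPolynomial (Fin m) (MvPolynomial (Fin n) Ω) := fun j => sumAlgEquiv Ω _ _ (q j)
  have hev : ∀ j, eval₂ (aeval (ℓ j) : _ →ₐ[Ω] MvPolynomial (Fin k) Ω).toRingHom f (L j) =
      aeval (Sum.elim f (ℓ j)) (q j) := by
    intro j
    have : ((eval₂Hom (aeval (ℓ j) : _ →ₐ[Ω] MvPolynomial (Fin k) Ω).toRingHom f).comp
        (sumAlgEquiv Ω (Fin m) (Fin n)).toAlgHom.toRingHom) =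
        (aeval (R := Ω) (Sum.elim f (ℓ j))).toRingHom := by
      ext i
      · change coeff _ (eval₂ _ f (sumAlgEquiv Ω _ _ (algebraMap Ω _ i))) = _
        rw [AlgEquiv.commutes, IsScalarTower.algebraMap_apply Ω (MvPolynomial (Fin n) Ω),
          algebraMap_eq, algebraMap_eq, eval₂_C]
        simp
      · change coeff _ (eval₂ _ f (sumAlgEquiv Ω _ _ (X i))) = _
        rcases i with i | i
        · rw [sumAlgEquiv_X_inl]
          simp
        · rw [sumAlgEquiv_X_inr]
          simp
    exact congrArg (fun h => h (q j)) this
  let p : MvPolynomial (Fin m) (MvPolynomial (Fin k) Ω) :=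
    ∑ j, C (H (Q j) * g j) * map (aeval (ℓ j) : _ →ₐ[Ω] MvPolynomial (Fin k) Ω).toRingHom (L j)
  have hcoeff : ∀ b, coeff b p = ∑ j, H (Q j) * g j * aeval (ℓ j) (coeff b (L j)) := by
    intro b
    simp only [p, coeff_sum, coeff_C_mul, coeff_map]
    rfl
  have hmem : ∀ b, (∀ i, coeff b p ∈ Q i) → (fun j => coeff b (L j)) = 0 := by
    intro b hb
    refine hc.eq_zero_of_sum_mem hH hH' hg hg' fun i => ?_
    have := hb i
    rwa [hcoeff] at this
  have hp : p = 0 := by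
    refine eq_zero_of_eval_eq_zero Ω (h := f) hc.mem_minimalPrimes hc.le_height ?_ ?_
    · rw [← hq]
      simp only [p, map_sum, map_mul, eval_C, eval_map, hev]
    · intro b hb
      rw [hcoeff]
      refine Finset.sum_eq_zero fun j _ => ?_
      rw [congrFun (hmem b hb) j]
      simp
  funext j
  have : L j = 0 := by
    ext1 b
    refine congrFun (hmem b fun i => ?_) j
    rw [hp, coeff_zero]
    exact Ideal.zero_mem _
  simpa [L] using this

end BezoutBound

end AffineVariety


namespace AffineVariety

open MvPolynomial

/-! ### Counting monomials -/

section Count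

/-- If `N ≥ D + 1`, iterating `r` times bounds `((D + 1) / D) ^ r` by a polynomial in `r`, which
fails for large `r`. -/
theorem le_of_forall_mul_le {M : ℕ → ℕ} {N D c k : ℕ} (h0 : 0 < M 0)
    (hM : ∀ T, M T ≤ (T + 1) ^ k) (h : ∀ T, N * M T ≤ D * M (T + c)) : N ≤ D := by
  by_contra! hlt
  have h1 : ∀ r, (D + 1) ^ r * M 0 ≤ D ^ r * M (r * c) := by
    intro r
    induction r with
    | zero => simp
    | succ r ih =>
      calc (D + 1) ^ (r + 1) * M 0 = (D + 1) * ((D + 1) ^ r * M 0) := by ring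
        _ ≤ (D + 1) * (D ^ r * M (r * c)) := Nat.mul_le_mul_left _ ih
        _ = D ^ r * ((D + 1) * M (r * c)) := by ring
        _ ≤ D ^ r * (N * M (r * c)) := Nat.mul_le_mul_left _ (Nat.mul_le_mul_right _ hlt)
        _ ≤ D ^ r * (D * M (r * c + c)) := Nat.mul_le_mul_left _ (h _)
        _ = D ^ (r + 1) * M ((r + 1) * c) := by ring_nf
  have h2 : ∀ r, 1 ≤ r → (D + 1) ^ r ≤ D ^ r * ((c + 1) ^ k * r ^ k) := by
    intro r hr
    refine (Nat.le_mul_of_pos_right _ h0).trans ((h1 r).trans (Nat.mul_le_mul_left _ ?_))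
    refine (hM _).trans ?_
    rw [← mul_pow]
    refine Nat.pow_le_pow_left ?_ k
    nlinarith
  have hD : 0 < D := by
    by_contra! hD
    obtain rfl : D = 0 := by omega
    simpa using h2 1 le_rfl
  have hD' : (0 : ℝ) < D := by exact_mod_cast hD
  have ha : (1 : ℝ) < (D + 1) / D := by rw [one_lt_div hD']; linarith
  have ht := (tendsto_pow_const_div_const_pow_of_one_lt k ha).const_mul ((c + 1 : ℝ) ^ k)
  rw [mul_zero] at ht
  obtain ⟨r, hr, hr1⟩ := ((ht.eventually (gt_mem_nhds one_pos)).and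
    (Filter.eventually_ge_atTop 1)).exists
  have h3 : ((D + 1 : ℝ)) ^ r ≤ D ^ r * ((c + 1) ^ k * r ^ k) := by exact_mod_cast h2 r hr1
  rw [div_pow, div_div_eq_mul_div, mul_div_assoc', div_lt_one (by positivity)] at hr
  linarith

variable {σ : Type*}

/-- The exponents of weight at most `T`. -/
def weightLE (w : σ → ℕ) (T : ℕ) : Set (σ →₀ ℕ) := {e | Finsupp.weight w e ≤ T}

theorem finite_weightLE [Finite σ] {w : σ → ℕ} (hw : ∀ s, 0 < w s) (T : ℕ) :
    Finite (weightLE w T) :=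
  (Finsupp.finite_of_nat_weight_le w (fun s => (hw s).ne') T).to_subtype

theorem mem_weightLE_one {T : ℕ} {e : σ →₀ ℕ} :
    e ∈ weightLE (1 : σ → ℕ) T ↔ e.degree ≤ T := by
  simp [weightLE, Finsupp.weight_apply, Finsupp.degree_apply, Finsupp.sum]

/-- Divide each exponent by its weight: the quotients have weight at most `T`, and the remainders
take at most `∏ w s` values. -/
theorem card_weightLE_one_le [Fintype σ] {w : σ → ℕ} (hw : ∀ s, 0 < w s) (T : ℕ) :
    Nat.card (weightLE (1 : σ → ℕ) T) ≤ Nat.card (weightLE w T) * ∏ s, w s := by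
  classical
  have := finite_weightLE hw T
  let F : weightLE (1 : σ → ℕ) T → weightLE w T × ∀ s, Fin (w s) := fun e =>
    (⟨Finsupp.equivFunOnFinite.symm fun s => e.1 s / w s, by
      have h := e.2
      simp only [weightLE, Set.mem_ofPred_eq, Finsupp.weight_apply] at h ⊢
      rw [Finsupp.sum_fintype _ _ (by simp)] at h ⊢
      refine le_trans (Finset.sum_le_sum fun s _ => ?_) h
      simpa using Nat.div_mul_le_self _ _⟩,
    fun s => ⟨e.1 s % w s, Nat.mod_lt _ (hw s)⟩)
  have hF : Function.Injective F := by
    intro e e' h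
    obtain ⟨h1, h2⟩ := Prod.ext_iff.1 h
    ext s
    have h3 : e.1 s / w s = e'.1 s / w s := DFunLike.congr_fun (Subtype.ext_iff.1 h1) s
    have h4 : e.1 s % w s = e'.1 s % w s := Fin.ext_iff.1 (congrFun h2 s)
    rw [← Nat.div_add_mod (e.1 s) (w s), h3, h4, Nat.div_add_mod]
  refine (Nat.card_le_card_of_injective F hF).trans_eq ?_
  rw [Nat.card_prod, Nat.card_pi]
  simp

theorem card_weightLE_one_le_pow [Fintype σ] (T : ℕ) :
    Nat.card (weightLE (1 : σ → ℕ) T) ≤ (T + 1) ^ Fintype.card σ := by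
  let F : weightLE (1 : σ → ℕ) T → σ → Fin (T + 1) := fun e s => ⟨e.1 s, by
    have h := mem_weightLE_one.1 e.2
    have := Finsupp.le_degree s e.1
    omega⟩
  have hF : Function.Injective F := fun e e' h => by
    ext s
    exact Fin.ext_iff.1 (congrFun h s)
  refine (Nat.card_le_card_of_injective F hF).trans_eq ?_
  rw [Nat.card_fun, Nat.card_eq_fintype_card, Nat.card_eq_fintype_card, Fintype.card_fin]

theorem card_weightLE_one_congr {τ : Type*} (g : σ ≃ τ) (T : ℕ) :
    Nat.card (weightLE (1 : σ → ℕ) T) = Nat.card (weightLE (1 : τ → ℕ) T) := by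
  refine Nat.card_congr (Equiv.subtypeEquiv (Finsupp.domCongr g).toEquiv fun e => ?_)
  rw [mem_weightLE_one, mem_weightLE_one, ← Finsupp.degree_mapDomain g e,
    ← Finsupp.equivMapDomain_eq_mapDomain]
  rfl

end Count

/-! ### The Bézout inequality -/

section BezoutBound

variable {Ω : Type*} [Field Ω] {k m n : ℕ} {ι : Type*}
    {f : Fin m → MvPolynomial (Fin k) Ω}
    {Q : ι → Ideal (MvPolynomial (Fin k) Ω)} {ℓ : ι → Fin n → MvPolynomial (Fin k) Ω}
    {x : ι → Fin k → Ω}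

theorem finrank_restrictTotalDegree (T : ℕ) :
    Module.finrank Ω (restrictTotalDegree (Fin k) Ω T) =
      Nat.card (weightLE (1 : Fin k → ℕ) T) := by
  have : {e : Fin k →₀ ℕ | (e.sum fun _ a => a) ≤ T} = weightLE 1 T := by
    ext e
    simp [weightLE, Finsupp.weight_apply]
  rw [restrictTotalDegree, Module.finrank_eq_nat_card_basis (basisRestrictSupport Ω _), this]

theorem totalDegree_aeval_monomial_le {σ : Type*} [Fintype σ] {w : σ → ℕ}
    {h : σ → MvPolynomial (Fin k) Ω} (hw : ∀ s, (h s).totalDegree ≤ w s) (e : σ →₀ ℕ) :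
    (aeval h (monomial e (1 : Ω))).totalDegree ≤ Finsupp.weight w e := by
  rw [aeval_monomial, map_one, one_mul, Finsupp.weight_apply, Finsupp.prod, Finsupp.sum]
  refine (totalDegree_finsetProd _ _).trans (Finset.sum_le_sum fun s _ => ?_)
  exact (totalDegree_pow _ _).trans (Nat.mul_le_mul_left _ (hw s))

/-- The products of `u i` with monomials of weight at most `T` in `f` and `ℓ i` are linearly
independent. Their degrees exceed `T` by at most the sum `c` of the degrees of the `u i`, which does
not depend on `T`. -/
theorem IsolatedPoints.exists_card_mul_le [Infinite Ω] [Fintype ι] (hc : IsolatedPoints f Q ℓ x)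
    {d : Fin m → ℕ} (hd : ∀ j, 0 < d j) (hf : ∀ j, (f j).totalDegree ≤ d j)
    (hℓ : ∀ i s, (ℓ i s).totalDegree ≤ 1) : ∃ c, ∀ T,
      Fintype.card ι * Nat.card (weightLE (Sum.elim d 1 : Fin m ⊕ Fin n → ℕ) T) ≤
        Nat.card (weightLE (1 : Fin k → ℕ) (T + c)) := by
  classical
  obtain ⟨u, hu⟩ := hc.exists_eq_zero_of_sum_mul_aeval_eq_zero
  refine ⟨∑ i, (u i).totalDegree, fun T => ?_⟩
  let w : Fin m ⊕ Fin n → ℕ := Sum.elim d 1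
  have hw : ∀ s, 0 < w s := by rintro (s | s) <;> simp [w, hd]
  have := finite_weightLE hw T
  have := Fintype.ofFinite (weightLE w T)
  let v : ι × weightLE w T → MvPolynomial (Fin k) Ω := fun t =>
    u t.1 * aeval (Sum.elim f (ℓ t.1)) (monomial t.2.1 (1 : Ω))
  have hv : ∀ t, v t ∈ restrictTotalDegree (Fin k) Ω (T + ∑ i, (u i).totalDegree) := by
    rintro ⟨i, e⟩
    rw [mem_restrictTotalDegree, add_comm]
    refine (totalDegree_mul _ _).trans (add_le_add ?_ (le_trans ?_ e.2))
    · exact Finset.single_le_sum (f := fun i => (u i).totalDegree) (fun _ _ => Nat.zero_le _)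
        (Finset.mem_univ i)
    · refine totalDegree_aeval_monomial_le ?_ _
      rintro (s | s)
      · exact hf s
      · exact hℓ i s
  have hli : LinearIndependent Ω v := by
    rw [Fintype.linearIndependent_iff]
    intro a ha t
    have h1 := hu (fun i => ∑ e : weightLE w T, monomial e.1 (a (i, e))) (by
      rw [← ha, Fintype.sum_prod_type]
      refine Finset.sum_congr rfl fun i _ => ?_
      rw [map_sum, Finset.mul_sum]
      refine Finset.sum_congr rfl fun e _ => ?_
      simp only [v]
      rw [← mul_smul_comm, ← map_smul, smul_monomial, smul_eq_mul, mul_one])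
    have h2 := congrArg (coeff t.2.1) (congrFun h1 t.1)
    rw [coeff_sum, Finset.sum_eq_single t.2] at h2
    · simpa using h2
    · intro e _ he
      rw [coeff_monomial, if_neg fun h => he (Subtype.ext h)]
    · simp
  have hli' : LinearIndependent Ω fun t => (⟨v t, hv t⟩ :
      restrictTotalDegree (Fin k) Ω (T + ∑ i, (u i).totalDegree)) :=
    LinearIndependent.of_comp (Submodule.subtype _) hli
  have := hli'.fintype_card_le_finrank
  rwa [Fintype.card_prod, finrank_restrictTotalDegree, ← Nat.card_eq_fintype_card
    (α := weightLE w T)] at this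

/-- A Bézout inequality. -/
theorem IsolatedPoints.card_le [Infinite Ω] [Fintype ι] (hc : IsolatedPoints f Q ℓ x)
    {d : Fin m → ℕ} (hd : ∀ j, 0 < d j) (hf : ∀ j, (f j).totalDegree ≤ d j)
    (hℓ : ∀ i s, (ℓ i s).totalDegree ≤ 1) (hk : m + n = k) : Fintype.card ι ≤ ∏ j, d j := by
  obtain ⟨c, h⟩ := hc.exists_card_mul_le hd hf hℓ
  have hw : ∀ s, 0 < (Sum.elim d 1 : Fin m ⊕ Fin n → ℕ) s := by rintro (s | s) <;> simp [hd]
  refine le_of_forall_mul_le (M := fun T => Nat.card (weightLE (1 : Fin k → ℕ) T)) (c := c)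
    ?_ (fun T => (card_weightLE_one_le_pow T).trans_eq (by rw [Fintype.card_fin])) fun T => ?_
  · have := finite_weightLE (w := (1 : Fin k → ℕ)) (fun _ => one_pos) 0
    have : Nonempty (weightLE (1 : Fin k → ℕ) 0) := ⟨⟨0, by simp [weightLE]⟩⟩
    exact Nat.card_pos
  · calc Fintype.card ι * Nat.card (weightLE (1 : Fin k → ℕ) T)
        = Fintype.card ι * Nat.card (weightLE (1 : Fin m ⊕ Fin n → ℕ) T) := by
          rw [card_weightLE_one_congr ((finCongr hk.symm).trans finSumFinEquiv.symm)]
      _ ≤ Fintype.card ι * (Nat.card (weightLE (Sum.elim d 1 : Fin m ⊕ Fin n → ℕ) T) *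
            ∏ s, (Sum.elim d 1 : Fin m ⊕ Fin n → ℕ) s) :=
          Nat.mul_le_mul_left _ (card_weightLE_one_le hw T)
      _ = (∏ j, d j) * (Fintype.card ι *
            Nat.card (weightLE (Sum.elim d 1 : Fin m ⊕ Fin n → ℕ) T)) := by
          rw [Fintype.prod_sum_type]
          simp only [Sum.elim_inl, Sum.elim_inr, Pi.one_apply, Finset.prod_const_one, mul_one]
          ring
      _ ≤ (∏ j, d j) * Nat.card (weightLE (1 : Fin k → ℕ) (T + c)) :=
          Nat.mul_le_mul_left _ (h T)

end BezoutBound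

end AffineVariety


namespace AffineVariety

open MvPolynomial

/-! ### Irreducible varieties and primes over a subfield -/

section Nullstellensatz

variable {K : Type*} {Ω : Type*} [Field K] [Field Ω] [Algebra K Ω] {r : ℕ}

theorem IsVariety.zeroLocus_vanishingIdeal {V : Set (Fin r → Ω)} (hV : IsVariety K V) :
    zeroLocus Ω (vanishingIdeal K V) = V := by
  obtain ⟨I, rfl⟩ := hV
  exact (zeroLocus_vanishingIdeal_galoisConnection (k := K) (K := Ω)).l_u_l_eq_l I

theorem IsIrreducibleVariety.isPrime_vanishingIdeal {V : Set (Fin r → Ω)}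
    (hV : IsIrreducibleVariety K V) : (vanishingIdeal K V).IsPrime := by
  obtain ⟨hvar, ⟨x, hx⟩, hirr⟩ := hV
  refine ⟨fun h => ?_, fun {a b} hab => ?_⟩
  · have h1 : (1 : MvPolynomial (Fin r) K) ∈ vanishingIdeal K V := h ▸ Submodule.mem_top
    simpa using h1 x hx
  · have h1 : ∀ c : MvPolynomial (Fin r) K, IsVariety K {x ∈ V | aeval x c = 0} := by
      intro c
      refine ⟨vanishingIdeal K V ⊔ Ideal.span {c}, ?_⟩
      rw [(zeroLocus_vanishingIdeal_galoisConnection (k := K) (K := Ω)).l_sup]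
      change _ = zeroLocus Ω (vanishingIdeal K V) ∩ zeroLocus Ω (Ideal.span {c})
      rw [hvar.zeroLocus_vanishingIdeal, zeroLocus_span]
      ext
      simp
    have h2 : V = {x ∈ V | aeval x a = 0} ∪ {x ∈ V | aeval x b = 0} := by
      ext x
      have h3 : x ∈ V → aeval x a = 0 ∨ aeval x b = 0 := fun hx => by
        simpa using hab x hx
      simp only [Set.mem_union, Set.mem_ofPred_eq]
      tauto
    refine (hirr _ _ (h1 a) (h1 b) h2).imp (fun h x hx => ?_) fun h x hx => ?_ <;>
    · rw [h] at hx
      exact hx.2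

variable [IsAlgClosed Ω]

theorem isIrreducibleVariety_zeroLocus (P : Ideal (MvPolynomial (Fin r) K)) [hP : P.IsPrime] :
    IsIrreducibleVariety K (zeroLocus Ω P) := by
  have hI : vanishingIdeal K (zeroLocus Ω P) = P := IsPrime.vanishingIdeal_zeroLocus P
  refine ⟨⟨P, rfl⟩, ?_, fun V₁ V₂ h₁ h₂ h => ?_⟩
  · rw [Set.nonempty_iff_ne_empty]
    intro h
    rw [h, vanishingIdeal_empty] at hI
    exact hP.ne_top hI.symm
  · have h3 : vanishingIdeal K V₁ * vanishingIdeal K V₂ ≤ P := by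
      rw [← hI, h, Ideal.mul_le]
      rintro a ha b hb x (hx | hx)
      · rw [map_mul, ha x hx, zero_mul]
      · rw [map_mul, hb x hx, mul_zero]
    refine (hP.mul_le.1 h3).imp (fun h4 => ?_) fun h4 => ?_
    · refine Set.Subset.antisymm ?_ (h ▸ Set.subset_union_left)
      rw [← h₁.zeroLocus_vanishingIdeal]
      exact zeroLocus_anti_mono h4
    · refine Set.Subset.antisymm ?_ (h ▸ Set.subset_union_right)
      rw [← h₂.zeroLocus_vanishingIdeal]
      exact zeroLocus_anti_mono h4

/-- By the Nullstellensatz for `Ω`-points, vanishing ideals give an order-reversing bijection from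
irreducible `K`-subvarieties to primes containing `I`. -/
theorem dim_zeroLocus (I : Ideal (MvPolynomial (Fin r) K)) :
    dim K (zeroLocus Ω I) = ringKrullDim (MvPolynomial (Fin r) K ⧸ I) := by
  let e : {W : Set (Fin r → Ω) // IsIrreducibleVariety K W ∧ W ⊆ zeroLocus Ω I} ≃o
      (PrimeSpectrum.zeroLocus (I : Set (MvPolynomial (Fin r) K)))ᵒᵈ :=
    { toFun := fun W => OrderDual.toDual ⟨⟨vanishingIdeal K W.1, W.2.1.isPrime_vanishingIdeal⟩,
        le_zeroLocus_iff_le_vanishingIdeal.1 W.2.2⟩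
      invFun := fun P => ⟨zeroLocus Ω (OrderDual.ofDual P).1.asIdeal,
        isIrreducibleVariety_zeroLocus _, zeroLocus_anti_mono (OrderDual.ofDual P).2⟩
      left_inv := fun W => Subtype.ext W.2.1.1.zeroLocus_vanishingIdeal
      right_inv := fun P => by
        refine congrArg OrderDual.toDual (Subtype.ext (PrimeSpectrum.ext ?_))
        exact IsPrime.vanishingIdeal_zeroLocus _
      map_rel_iff' := by
        intro W W'
        change vanishingIdeal K W'.1 ≤ vanishingIdeal K W.1 ↔ W.1 ⊆ W'.1
        refine ⟨fun h => ?_, fun h => vanishingIdeal_anti_mono h⟩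
        rw [← W.2.1.1.zeroLocus_vanishingIdeal, ← W'.2.1.1.zeroLocus_vanishingIdeal]
        exact zeroLocus_anti_mono h }
  rw [dim, Order.krullDim_eq_of_orderIso e, Order.krullDim_orderDual, ringKrullDim_quotient]

theorem IsComponent.exists_mem_minimalPrimes {I : Ideal (MvPolynomial (Fin r) K)}
    {C : Set (Fin r → Ω)} (hC : IsComponent K (zeroLocus Ω I) C) :
    ∃ P ∈ I.minimalPrimes, C = zeroLocus Ω P := by
  have hP := hC.1.1.isPrime_vanishingIdeal
  have hZ := hC.1.1.1.zeroLocus_vanishingIdeal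
  refine ⟨vanishingIdeal K C, ⟨⟨hP, le_zeroLocus_iff_le_vanishingIdeal.1 hC.1.2⟩, ?_⟩, hZ.symm⟩
  rintro P ⟨hP', hIP⟩ hle
  rw [← IsPrime.vanishingIdeal_zeroLocus (K := Ω) P]
  exact vanishingIdeal_anti_mono (hC.2 ⟨isIrreducibleVariety_zeroLocus P, zeroLocus_anti_mono hIP⟩
    (hZ.symm.trans_le (zeroLocus_anti_mono hle)))

end Nullstellensatz

end AffineVariety


namespace AffineVariety

open MvPolynomial

/-- Going down gives a prime over `P` inside `M`. A minimal prime of the extended ideal below it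
contracts to a prime between `I` and `P`, hence to `P` by minimality. -/
theorem exists_mem_minimalPrimes_map {R S : Type*} [CommRing R] [CommRing S] [Algebra R S]
    [Algebra.HasGoingDown R S] {I P : Ideal R} (hP : P ∈ I.minimalPrimes) {M : Ideal S}
    [hM : M.IsPrime] (hPM : P ≤ M.comap (algebraMap R S)) :
    ∃ Q ∈ (I.map (algebraMap R S)).minimalPrimes, Q ≤ M ∧ Q.comap (algebraMap R S) = P := by
  have hPp : P.IsPrime := hP.1.1
  have : M.LiesOver (M.comap (algebraMap R S)) := ⟨rfl⟩
  obtain ⟨Q₀, hQM, hQ₀, hQP⟩ := Ideal.exists_ideal_le_liesOver_of_le M hPM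
  have hQP' : Q₀.comap (algebraMap R S) = P := hQP.over.symm
  obtain ⟨Q, hQ, hQQ⟩ := Ideal.exists_minimalPrimes_le
    (Ideal.map_le_iff_le_comap.2 (hP.1.2.trans hQP'.ge))
  have hQp : Q.IsPrime := hQ.1.1
  refine ⟨Q, hQ, hQQ.trans hQM, ?_⟩
  have h1 : Q.comap (algebraMap R S) ≤ P := (Ideal.comap_mono hQQ).trans_eq hQP'
  exact le_antisymm h1 (hP.2 ⟨inferInstance, Ideal.map_le_iff_le_comap.1 hQ.1.2⟩ h1)

/-! ### Base change to the algebraically closed field -/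

section BaseChange

attribute [local instance] MvPolynomial.algebraMvPolynomial

variable {K : Type*} (Ω : Type*) [Field K] [Field Ω] [Algebra K Ω] {k m : ℕ}

theorem free_mvPolynomial : Module.Free (MvPolynomial (Fin k) K) (MvPolynomial (Fin k) Ω) :=
  IsBaseChange.free (Algebra.IsPushout.out (R := K) (S := MvPolynomial (Fin k) K) (R' := Ω)
    (S' := MvPolynomial (Fin k) Ω))

theorem comap_map_mvPolynomial (I : Ideal (MvPolynomial (Fin k) K)) :
    (I.map (map (algebraMap K Ω))).comap (map (algebraMap K Ω)) = I := by
  have := free_mvPolynomial (K := K) Ω (k := k)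
  exact Ideal.comap_map_eq_self_of_faithfullyFlat (B := MvPolynomial (Fin k) Ω) I

theorem comap_vanishingIdeal_singleton (x : Fin k → Ω) :
    (vanishingIdeal Ω {x}).comap (map (algebraMap K Ω)) = vanishingIdeal K {x} := by
  ext p
  simp only [Ideal.mem_comap, mem_vanishingIdeal_singleton_iff, aeval_map_algebraMap]

variable {Ω}

theorem exists_mem_minimalPrimes_map_le {I P : Ideal (MvPolynomial (Fin k) K)}
    (hP : P ∈ I.minimalPrimes) {x : Fin k → Ω} (hx : x ∈ zeroLocus Ω P) :
    ∃ Q ∈ (I.map (map (algebraMap K Ω))).minimalPrimes, Q ≤ vanishingIdeal Ω {x} ∧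
      Q.comap (map (algebraMap K Ω)) = P := by
  have := free_mvPolynomial (K := K) Ω (k := k)
  have := Algebra.HasGoingDown.of_flat (R := MvPolynomial (Fin k) K) (S := MvPolynomial (Fin k) Ω)
  refine exists_mem_minimalPrimes_map (S := MvPolynomial (Fin k) Ω) hP ?_
  refine le_trans ?_ (comap_vanishingIdeal_singleton Ω x).ge
  exact fun p hp => (mem_vanishingIdeal_singleton_iff _ _).2 (hx p hp)

theorem ringKrullDim_quotient_le_quotient_comap [Algebra.IsAlgebraic K Ω]
    (Q : Ideal (MvPolynomial (Fin k) Ω)) :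
    ringKrullDim (MvPolynomial (Fin k) Ω ⧸ Q) ≤
      ringKrullDim (MvPolynomial (Fin k) K ⧸ Q.comap (map (algebraMap K Ω))) := by
  refine ringKrullDim_le_of_isIntegral (Ideal.quotientMap Q (map (algebraMap K Ω)) le_rfl) ?_
  refine RingHom.IsIntegral.quotient (map (algebraMap K Ω)) ?_
  exact algebraMap_isIntegral_iff.2
    (inferInstanceAs (Algebra.IsIntegral (MvPolynomial (Fin k) K) (MvPolynomial (Fin k) Ω)))

end BaseChange

/-! ### Complete intersection over the base field -/

section CompleteIntersection

variable {K Ω : Type*} [Field K] [Field Ω] [Algebra K Ω] {k m : ℕ} {d : Fin m → ℕ} {b : Fin m → K}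

theorem map_diagonal (j : Fin m) : map (algebraMap K Ω) (diagonal k d b j) =
    diagonal k d (algebraMap K Ω ∘ b) j := by
  simp [diagonal]

theorem map_span_diagonal :
    (Ideal.span (Set.range (diagonal k d b))).map (map (algebraMap K Ω)) =
      Ideal.span (Set.range (diagonal k d (algebraMap K Ω ∘ b))) := by
  rw [Ideal.map_span, ← Set.range_comp]
  congr 2
  funext j
  exact map_diagonal j

theorem zeros_eq_zeroLocus (F : Fin m → MvPolynomial (Fin k) K) :
    zeros Ω F = zeroLocus Ω (Ideal.span (Set.range F)) := by
  rw [zeroLocus_span]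
  ext x
  simp [zeros]

theorem algebraMap_natCast_ne_zero (hdK : ∀ j, (d j : K) ≠ 0) (j : Fin m) : (d j : Ω) ≠ 0 := by
  rw [← map_natCast (algebraMap K Ω)]
  exact (map_ne_zero _).2 (hdK j)

variable [IsAlgClosed Ω]

theorem span_diagonal_ne_top_of_algebra (hd : ∀ j, 0 < d j) (hinj : Function.Injective d)
    (hdK : ∀ j, (d j : Ω) ≠ 0) (hmk : 2 * m ≤ k + 1) (hmk' : m ≤ k) :
    Ideal.span (Set.range (diagonal k d b)) ≠ ⊤ := by
  intro h
  have := span_diagonal_ne_top (Ω := Ω) (b := algebraMap K Ω ∘ b) hd hinj hdK hmk hmk'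
  rw [← map_span_diagonal, h, Ideal.map_top] at this
  exact this rfl

theorem isRadical_span_diagonal_of_algebra (hd : ∀ j, 0 < d j) (hinj : Function.Injective d)
    (hdK : ∀ j, (d j : Ω) ≠ 0) (hmk : 2 * m ≤ k) :
    (Ideal.span (Set.range (diagonal k d b))).IsRadical := by
  have := isRadical_span_diagonal (Ω := Ω) (b := algebraMap K Ω ∘ b) hd hinj hdK hmk
  rw [← map_span_diagonal] at this
  have := this.comap (map (algebraMap K Ω))
  rwa [comap_map_mvPolynomial] at this

/-- The upper bound holds over any field. For the lower bound, lift `P` to a minimal prime `Q` over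
`Ω`, where depth gives a long chain; integrality transfers it to `P`. -/
theorem ringKrullDim_quotient_eq_of_mem_minimalPrimes [Algebra.IsAlgebraic K Ω]
    (hd : ∀ j, 0 < d j) (hinj : Function.Injective d)
    (hdK : ∀ j, (d j : K) ≠ 0) (hmk : 2 * m ≤ k + 1) {P : Ideal (MvPolynomial (Fin k) K)}
    (hP : P ∈ (Ideal.span (Set.range (diagonal k d b))).minimalPrimes) :
    ringKrullDim (MvPolynomial (Fin k) K ⧸ P) = ((k - m : ℕ) : WithBot ℕ∞) := by
  have hPp : P.IsPrime := hP.1.1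
  refine le_antisymm (ringKrullDim_quotient_le_of_diagonal_mem hd hinj hdK hmk
    fun j => hP.1.2 (Ideal.subset_span ⟨j, rfl⟩)) ?_
  obtain ⟨x, hx⟩ := (isIrreducibleVariety_zeroLocus (Ω := Ω) P).2.1
  obtain ⟨Q, hQ, hQx, rfl⟩ := exists_mem_minimalPrimes_map_le hP hx
  have hQp : Q.IsPrime := hQ.1.1
  rw [map_span_diagonal] at hQ
  obtain ⟨w, hw⟩ := exists_mem_iff_of_mem_minimalPrimes hQ
  obtain ⟨l, hl, hhead, hlast⟩ := exists_ltSeries_of_mem_iff hd hinj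
    (algebraMap_natCast_ne_zero hdK) hmk hQp hw hQx
  rw [← hl]
  exact (length_le_ringKrullDim_quotient l hhead hlast).trans
    (ringKrullDim_quotient_le_quotient_comap Q)

theorem hasPureDim_zeros_diagonal [Algebra.IsAlgebraic K Ω]
    (hd : ∀ j, 0 < d j) (hinj : Function.Injective d)
    (hdK : ∀ j, (d j : K) ≠ 0) (hmk : 2 * m ≤ k + 1) (hmk' : m ≤ k) :
    HasPureDim K (zeros Ω (diagonal k d b)) (k - m) := by
  rw [zeros_eq_zeroLocus]
  refine ⟨?_, fun C hC => ?_⟩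
  · rw [dim_zeroLocus]
    refine le_antisymm (ringKrullDim_quotient_le_of_forall fun P hP hIP => ?_) ?_
    · exact ringKrullDim_quotient_le_of_diagonal_mem hd hinj hdK hmk
        fun j => hIP (Ideal.subset_span ⟨j, rfl⟩)
    · obtain ⟨M, hM, hIM⟩ := Ideal.exists_le_maximal _ (span_diagonal_ne_top_of_algebra (Ω := Ω)
        (b := b) hd hinj (algebraMap_natCast_ne_zero hdK) hmk hmk')
      obtain ⟨P, hP, -⟩ := Ideal.exists_minimalPrimes_le hIM
      rw [← ringKrullDim_quotient_eq_of_mem_minimalPrimes (Ω := Ω) hd hinj hdK hmk hP]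
      exact ringKrullDim_le_of_surjective (Ideal.Quotient.factor hP.1.2)
        (Ideal.Quotient.factor_surjective hP.1.2)
  · obtain ⟨P, hP, rfl⟩ := hC.exists_mem_minimalPrimes
    rw [dim_zeroLocus, ringKrullDim_quotient_eq_of_mem_minimalPrimes (Ω := Ω) hd hinj hdK hmk hP]

theorem isCompleteIntersection_diagonal [Algebra.IsAlgebraic K Ω]
    (hd : ∀ j, 0 < d j) (hinj : Function.Injective d)
    (hdK : ∀ j, (d j : K) ≠ 0) (hmk : 2 * m ≤ k) :
    IsCompleteIntersection Ω (diagonal k d b) :=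
  ⟨by omega, hasPureDim_zeros_diagonal hd hinj hdK (by omega) (by omega),
    isRadical_span_diagonal_of_algebra hd hinj (algebraMap_natCast_ne_zero (Ω := Ω) hdK) hmk⟩

end CompleteIntersection

end AffineVariety


namespace AffineVariety

open MvPolynomial

/-! ### Isolated points of linear sections -/

section LinearSections

variable {Ω : Type*} [Field Ω] {k n : ℕ}

theorem exists_linear_equations {L : AffineSubspace Ω (Fin k → Ω)}
    (hne : (L : Set (Fin k → Ω)).Nonempty) (hL : Module.finrank Ω L.direction + n = k) :
    ∃ ℓ : Fin n → MvPolynomial (Fin k) Ω, (∀ s, (ℓ s).totalDegree ≤ 1) ∧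
      ∀ y, y ∈ L ↔ ∀ s, aeval y (ℓ s) = 0 := by
  obtain ⟨x₀, hx₀⟩ := hne
  have hfin : Module.finrank Ω ((Fin k → Ω) ⧸ L.direction) = Module.finrank Ω (Fin n → Ω) := by
    have := Submodule.finrank_quotient_add_finrank L.direction
    rw [Module.finrank_fin_fun] at this ⊢
    omega
  let φ : (Fin k → Ω) →ₗ[Ω] (Fin n → Ω) :=
    (LinearEquiv.ofFinrankEq _ _ hfin).toLinearMap ∘ₗ L.direction.mkQ
  have hφ : ∀ v, φ v = 0 ↔ v ∈ L.direction := by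
    intro v
    simp [φ]
  refine ⟨fun s => (∑ t, C (φ (Pi.single t 1) s) * X t) - C (φ x₀ s), fun s => ?_, fun y => ?_⟩
  · refine (totalDegree_sub_C_le _ _).trans (totalDegree_finsetSum_le fun t _ => ?_)
    refine (totalDegree_mul _ _).trans ?_
    simp
  · have h1 : ∀ s, aeval y ((∑ t, C (φ (Pi.single t 1) s) * X t) - C (φ x₀ s)) =
        φ (y - x₀) s := by
      intro s
      rw [map_sub φ, Pi.sub_apply, LinearMap.pi_apply_eq_sum_univ φ y]
      have h2 : ∀ t : Fin k, (Pi.single t 1 : Fin k → Ω) = fun j => if t = j then 1 else 0 := by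
        intro t
        ext j
        simp [Pi.single_apply, eq_comm]
      simp [mul_comm, h2]
    simp only [h1]
    rw [← AffineSubspace.vsub_right_mem_direction_iff_mem hx₀, vsub_eq_sub, ← hφ, funext_iff]
    rfl

/-- A prime between `(Q, ℓ)` and the ideal of `x` has finite zero locus, so it contains a finite
intersection of point ideals, hence one of them. By maximality that one is the ideal of `x`. -/
theorem map_mem_minimalPrimes_of_finite [IsAlgClosed Ω] {Q : Ideal (MvPolynomial (Fin k) Ω)}
    {ℓ : Fin n → MvPolynomial (Fin k) Ω} {x : Fin k → Ω} (hQ : Q ≤ vanishingIdeal Ω {x})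
    (hx : ∀ s, aeval x (ℓ s) = 0)
    (hfin : (zeroLocus Ω Q ∩ {y | ∀ s, aeval y (ℓ s) = 0}).Finite) :
    (vanishingIdeal Ω {x}).map (Ideal.Quotient.mk Q) ∈
      (Ideal.span (Set.range fun s => Ideal.Quotient.mk Q (ℓ s))).minimalPrimes := by
  have hmap : (vanishingIdeal Ω {x}).map (Ideal.Quotient.mk Q) |>.IsPrime :=
    Ideal.map_isPrime_of_surjective Ideal.Quotient.mk_surjective (by rwa [Ideal.mk_ker])
  refine ⟨⟨hmap, ?_⟩, ?_⟩
  · rw [Ideal.span_le]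
    rintro _ ⟨s, rfl⟩
    exact Ideal.mem_map_of_mem _ ((mem_vanishingIdeal_singleton_iff _ _).2 (hx s))
  · rintro 𝔮 ⟨h𝔮, hℓ⟩ hle
    let Q' := 𝔮.comap (Ideal.Quotient.mk Q)
    have hQ'x : Q' ≤ vanishingIdeal Ω {x} := by
      refine (Ideal.comap_mono hle).trans fun p hp => ?_
      exact (Ideal.mem_quotient_iff_mem hQ).1 hp
    have hfin' : (zeroLocus Ω Q').Finite := by
      refine hfin.subset fun y hy => ⟨fun p hp => hy p ?_, fun s => hy _ ?_⟩
      · rw [Ideal.mem_comap, Ideal.Quotient.eq_zero_iff_mem.2 hp]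
        exact 𝔮.zero_mem
      · exact hℓ (Ideal.subset_span ⟨s, rfl⟩)
    have hinf : hfin'.toFinset.inf (fun y => (vanishingIdeal Ω {y} :
        Ideal (MvPolynomial (Fin k) Ω))) ≤ Q' := by
      intro p hp
      rw [← IsPrime.vanishingIdeal_zeroLocus (K := Ω) Q']
      intro y hy
      rw [Submodule.mem_finsetInf] at hp
      exact hp y (hfin'.mem_toFinset.2 hy) y rfl
    obtain ⟨y, -, hy⟩ := (Ideal.IsPrime.inf_le' inferInstance).1 hinf
    have hyx : vanishingIdeal Ω {y} = (vanishingIdeal Ω {x} : Ideal (MvPolynomial (Fin k) Ω)) :=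
      Ideal.IsMaximal.eq_of_le inferInstance (Ideal.IsPrime.ne_top inferInstance) (hy.trans hQ'x)
    rw [Ideal.map_le_iff_le_comap]
    exact hyx ▸ hy

end LinearSections

/-! ### The degree bound -/

section Degree

variable {K Ω : Type*} [Field K] [Field Ω] [Algebra K Ω] {k m : ℕ} {d : Fin m → ℕ} {b : Fin m → K}

/-- Points of `C` witnessing that `C` has degree at least `N`. -/
theorem exists_points_of_le_degIrreducible {C : Set (Fin k → Ω)} {n N : ℕ}
    (hC : dim K C = (n : WithBot ℕ∞)) (hN : (N : ℕ∞) ≤ degIrreducible K C) :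
    ∃ (T : Finset (Fin k → Ω)) (ℓ : Fin n → MvPolynomial (Fin k) Ω), T.card = N ∧
      (∀ s, (ℓ s).totalDegree ≤ 1) ∧ ∀ x ∈ T, x ∈ C ∧ (∀ s, aeval x (ℓ s) = 0) ∧
        (C ∩ {y | ∀ s, aeval y (ℓ s) = 0}).Finite := by
  cases N with
  | zero => exact ⟨∅, 0, by simp⟩
  | succ N =>
    have hlt : (N : ℕ∞) < degIrreducible K C :=
      lt_of_lt_of_le (by exact_mod_cast Nat.lt_succ_self N) hN
    rw [degIrreducible, lt_iSup_iff] at hlt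
    obtain ⟨L, hlt⟩ := hlt
    rw [lt_iSup_iff] at hlt
    obtain ⟨⟨hne, hdim, hfin⟩, hlt⟩ := hlt
    rw [hC] at hdim
    obtain ⟨ℓ, hℓ, hLℓ⟩ := exists_linear_equations hne (n := n) (by exact_mod_cast hdim)
    have hL : (L : Set (Fin k → Ω)) = {y | ∀ s, aeval y (ℓ s) = 0} := Set.ext hLℓ
    rw [hL] at hlt hfin
    rw [hfin.encard_eq_coe_toFinset_card, Nat.cast_lt] at hlt
    obtain ⟨T, hT, hcard⟩ := Finset.exists_subset_card_eq (Nat.succ_le_of_lt hlt)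
    refine ⟨T, ℓ, hcard, hℓ, fun x hx => ?_⟩
    have := hfin.mem_toFinset.1 (hT hx)
    exact ⟨this.1, this.2, hfin⟩

theorem sum_le_of_forall_natCast_le {ι : Type*} (s : Finset ι) {g : ι → ℕ∞} {D : ℕ}
    (h : ∀ N : ι → ℕ, (∀ i, (N i : ℕ∞) ≤ g i) → ∑ i ∈ s, N i ≤ D) : ∑ i ∈ s, g i ≤ D := by
  by_contra! hlt
  -- Truncating at `D + 1` keeps every term finite; a term that reaches the cutoff already makes the
  -- sum exceed `D`.
  have hmin : ∀ i, ((min (g i) (D + 1)).toNat : ℕ∞) = min (g i) (D + 1) := fun i =>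
    ENat.natCast_toNat (ne_top_of_le_ne_top (by exact_mod_cast ENat.natCast_ne_top (D + 1))
      (min_le_right _ _))
  have h1 := h (fun i => (min (g i) (D + 1)).toNat) fun i => (hmin i).trans_le (min_le_left _ _)
  have h2 : ∑ i ∈ s, min (g i) (D + 1) ≤ (D : ℕ∞) := by
    rw [← Finset.sum_congr rfl fun i _ => hmin i]
    exact_mod_cast h1
  by_cases h3 : ∃ i ∈ s, (D + 1 : ℕ∞) ≤ g i
  · obtain ⟨i, hi, hgi⟩ := h3
    have h4 := (Finset.single_le_sum (f := fun i => min (g i) (D + 1 : ℕ∞))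
      (fun _ _ => zero_le) hi).trans h2
    simp only [min_eq_right hgi] at h4
    have : D + 1 ≤ D := by exact_mod_cast h4
    omega
  · push Not at h3
    rw [Finset.sum_congr rfl fun i hi => min_eq_left (h3 i hi).le] at h2
    exact absurd h2 (not_le.2 hlt)

theorem totalDegree_diagonal_le (j : Fin m) : (diagonal k d b j).totalDegree ≤ d j := by
  refine (totalDegree_sub_C_le _ _).trans (totalDegree_finsetSum_le fun t _ => ?_)
  exact (totalDegree_X_pow _ _).le

variable [IsAlgClosed Ω] [Algebra.IsAlgebraic K Ω]

/-- Bounding all finite families of witness points suffices. Each point of a `K`-component is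
assigned a minimal prime over `Ω` that contracts to the prime of that component and is contained in
the ideal of the point; the whole family is then fed to the Bézout inequality. -/
theorem degree_zeros_diagonal_le (hd : ∀ j, 0 < d j) (hinj : Function.Injective d)
    (hdK : ∀ j, (d j : K) ≠ 0) (hmk : 2 * m ≤ k + 1) (hmk' : m ≤ k) :
    degree K (zeros Ω (diagonal k d b)) ≤ ((∏ j, d j : ℕ) : ℕ∞) := by
  classical
  refine iSup_le fun s => sum_le_of_forall_natCast_le s fun N hN => ?_
  have hdΩ : ∀ j, (d j : Ω) ≠ 0 := algebraMap_natCast_ne_zero hdK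
  have hpure := hasPureDim_zeros_diagonal (Ω := Ω) (b := b) hd hinj hdK hmk hmk'
  choose T ℓ hcard hℓ hT using fun C : {C // IsComponent K (zeros Ω (diagonal k d b)) C} =>
    exists_points_of_le_degIrreducible (hpure.2 C.1 C.2) (hN C)
  have hmin : ∀ C, IsComponent K (zeros Ω (diagonal k d b)) C →
      ∃ P ∈ (Ideal.span (Set.range (diagonal k d b))).minimalPrimes, C = zeroLocus Ω P := by
    intro C hC
    rw [zeros_eq_zeroLocus] at hC
    exact hC.exists_mem_minimalPrimes
  choose P hP hCP using fun C : {C // IsComponent K (zeros Ω (diagonal k d b)) C} =>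
    hmin C.1 C.2
  let ι := Σ C : s, T C.1
  choose Q hQ hQx hQP using fun i : ι =>
    exists_mem_minimalPrimes_map_le (hP i.1.1) (x := i.2.1) (by
      rw [← hCP]; exact (hT i.1.1 _ i.2.2).1)
  have hQ' : ∀ i, Q i ∈ (Ideal.span (Set.range
      (diagonal k d (algebraMap K Ω ∘ b)))).minimalPrimes := by
    intro i
    rw [← map_span_diagonal]
    exact hQ i
  -- Contraction recovers the component from `Q i`, so the linear forms depend only on `Q i`, even
  -- when several primes over `Ω` lie on one `K`-component.
  have hfst : ∀ i j, Q i = Q j → i.1 = j.1 := by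
    intro i j h
    refine Subtype.ext (Subtype.ext ?_)
    rw [hCP, hCP, ← hQP, ← hQP, h]
  have hc : IsolatedPoints (diagonal k d (algebraMap K Ω ∘ b)) Q (fun i => ℓ i.1.1)
      (fun i : ι => i.2.1) := by
    refine ⟨hQ', fun i => ?_, fun i j h => ?_, fun i j h hx => ?_, hQx, fun i => ?_, fun i => ?_⟩
    · have := (hQ' i).1.1
      exact le_height_of_initialIdeal_le hd hinj hdΩ hmk le_rfl
        (initialIdeal_eq_span.trans_le (hQ' i).1.2)
    · simp only [hfst i j h]
    · obtain ⟨C, x, hxT⟩ := i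
      obtain ⟨C', x', hxT'⟩ := j
      obtain rfl : C = C' := hfst _ _ h
      obtain rfl : x = x' := hx
      rfl
    · have h1 := hT i.1.1 _ i.2.2
      refine map_mem_minimalPrimes_of_finite (hQx i) h1.2.1
        (h1.2.2.subset (Set.inter_subset_inter_left _ ?_))
      rw [hCP]
      intro y hy p hp
      rw [← hQP i, Ideal.mem_comap] at hp
      have := hy _ hp
      rwa [aeval_map_algebraMap] at this
    · have hQp := (hQ' i).1.1
      obtain ⟨w, hw⟩ := exists_mem_iff_of_mem_minimalPrimes (hQ' i)
      obtain ⟨l, hl, hhead, hlast⟩ := exists_ltSeries_of_mem_iff hd hinj hdΩ hmk hQp hw (hQx i)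
      rw [← hl]
      exact length_le_height_map_quotient l hhead hlast
  have := hc.card_le hd totalDegree_diagonal_le (fun i => hℓ i.1.1) (by omega)
  rw [Fintype.card_sigma] at this
  simp only [Fintype.card_coe, hcard] at this
  rwa [Finset.sum_coe_sort s N] at this

end Degree

end AffineVariety

theorem mainTheorem10 {𝔽 : Type*} [Field 𝔽] [Finite 𝔽] {Ω : Type*} [Field Ω] [Algebra 𝔽 Ω]
    [IsAlgClosure 𝔽 Ω] (k m : ℕ) (hm : 0 < m) (hmk : 2 * m + 1 ≤ k)
    (d : Fin m → ℕ) (hd : ∀ j, 2 ≤ d j) (hd_mono : StrictMono d)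
    (hp : ∀ j, ¬ ringChar 𝔽 ∣ d j) (b : Fin m → 𝔽) :
    let f : Fin m → MvPolynomial (Fin k) 𝔽 := AffineVariety.diagonal k d b
    let f' : Fin m → MvPolynomial (Fin k) Ω :=
      fun j => MvPolynomial.map (algebraMap 𝔽 Ω) (f j)
    let V : Set (Fin k → Ω) := AffineVariety.zeros Ω f
    (AffineVariety.IsCompleteIntersection Ω f ∧
      AffineVariety.HasPureDim 𝔽 V (k - m) ∧
      AffineVariety.degree 𝔽 V ≤ ((∏ j, d j : ℕ) : ℕ∞)) ∧
    (AffineVariety.IsCompleteIntersection Ω f' ∧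
      AffineVariety.HasPureDim Ω V (k - m) ∧
      AffineVariety.degree Ω V ≤ ((∏ j, d j : ℕ) : ℕ∞)) := by
  intro f f' V
  have hclosed : IsAlgClosed Ω := IsAlgClosure.isAlgClosed 𝔽
  have halg : Algebra.IsAlgebraic 𝔽 Ω := IsAlgClosure.isAlgebraic
  have hd0 : ∀ j, 0 < d j := fun j => lt_of_lt_of_le two_pos (hd j)
  have hdF : ∀ j, (d j : 𝔽) ≠ 0 := fun j h => hp j ((ringChar.spec 𝔽 (d j)).1 h)
  have hdΩ : ∀ j, (d j : Ω) ≠ 0 := AffineVariety.algebraMap_natCast_ne_zero hdF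
  -- Over `Ω` the system is again diagonal, so the geometric case is the same argument with base
  -- field `Ω`.
  have hf' : f' = AffineVariety.diagonal k d (algebraMap 𝔽 Ω ∘ b) :=
    funext AffineVariety.map_diagonal
  have hV : V = AffineVariety.zeros Ω (AffineVariety.diagonal k d (algebraMap 𝔽 Ω ∘ b)) := by
    rw [← hf']
    ext x
    simp only [V, f', AffineVariety.zeros, Set.mem_ofPred_eq, MvPolynomial.aeval_map_algebraMap]
  refine ⟨⟨?_, ?_, ?_⟩, ?_, ?_, ?_⟩
  · exact AffineVariety.isCompleteIntersection_diagonal hd0 hd_mono.injective hdF (by omega)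
  · exact AffineVariety.hasPureDim_zeros_diagonal hd0 hd_mono.injective hdF (by omega) (by omega)
  · exact AffineVariety.degree_zeros_diagonal_le hd0 hd_mono.injective hdF (by omega) (by omega)
  · rw [hf']
    exact AffineVariety.isCompleteIntersection_diagonal hd0 hd_mono.injective hdΩ (by omega)
  · rw [hV]
    exact AffineVariety.hasPureDim_zeros_diagonal hd0 hd_mono.injective hdΩ (by omega) (by omega)
  · rw [hV]
    exact AffineVariety.degree_zeros_diagonal_le hd0 hd_mono.injective hdΩ (by omega) (by omega)
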